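/- Every elliptic curve $E$ over $\mathbb{Q}$ has a unique minimal equation $y^2 = x^3 + Ax + B$ with $A, B \in \mathbb{Z}$ and $\gcd(A^3,B^2)$ not divisible by $k^{12}$ for any integer $k>1$; its naive height is $\operatorname{ht}(E) = \max\{|A|^3, |B|^2\}$. Say that $E$ has a rational $3$-isogeny if there is an isogeny $\phi : E \to E'$ to an elliptic curve $E'$ over $\mathbb{Q}$ such that $\ker(\phi)(\overline{\mathbb{Q}})$ is cyclic of order $3$ and stable under $\operatorname{Gal}(\overline{\mathbb{Q}}/\mathbb{Q})$. For real $X>0$ let $\mathcal{N}(3,X)_{j\neq 0}$ (respectively $\mathcal{N}(3,X)_{j=0}$) be the number of $\mathbb{Q}$-isomorphism classes of elliptic curves $E/\mathbb{Q}$ with $\operatorname{ht}(E)<X$, with a rational $3$-isogeny, and with $j(E) \neq 0$ (respectively $j(E)=0$). Write $F(X) \asymp G(X)$ if there are positive constants $K_1, K_2, X_0$ with $K_1 G(X) \le F(X) \le K_2 G(X)$ for all $X \ge X_0$. Then: (1) $\mathcal{N}(3,X)_{j\neq 0} \asymp X^{1/3}\log X$. (2) An elliptic curve $E/\mathbb{Q}$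 with $j(E)\neq 0$ has a rational $3$-isogeny if and only if it is isomorphic over $\mathbb{Q}$ to a quadratic twist of a member of the family $y^2 = x^3 + \left(2t-\tfrac13\right)x + \left(t^2-\tfrac23 t+\tfrac{2}{27}\right)$, that is, to $y^2 = x^3 + d^2\left(2t-\tfrac13\right)x + d^3\left(t^2-\tfrac23 t+\tfrac{2}{27}\right)$ for some $t, d\in\mathbb{Q}$ with $d \neq 0$. (3) $\mathcal{N}(3,X)_{j=0} \asymp X^{1/2}$. -/

import Mathlib

open scoped Asymptotics

namespace EllipticCount

/-! ### Elliptic curves over the rationals, up to isomorphism -/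

/-- An elliptic curve over `ℚ`, given by a (general) nonsingular Weierstrass equation. -/
abbrev EllipticCurveQ : Type := {W : WeierstrassCurve ℚ // W.IsElliptic}

instance instIsEllipticVal (E : EllipticCurveQ) : E.1.IsElliptic := E.2

/-- Isomorphism over `ℚ`: an admissible change of variables takes one Weierstrass equation to the
other. -/
def IsIsomorphic (W W' : WeierstrassCurve ℚ) : Prop :=
  ∃ C : WeierstrassCurve.VariableChange ℚ, C • W = W'

theorem IsIsomorphic.refl (W : WeierstrassCurve ℚ) : IsIsomorphic W W := ⟨1, one_smul _ _⟩

theorem IsIsomorphic.symm {W W' : WeierstrassCurve ℚ} (h : IsIsomorphic W W') :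
    IsIsomorphic W' W := by
  obtain ⟨C, rfl⟩ := h
  exact ⟨C⁻¹, inv_smul_smul C W⟩

theorem IsIsomorphic.trans {W W' W'' : WeierstrassCurve ℚ} (h : IsIsomorphic W W')
    (h' : IsIsomorphic W' W'') : IsIsomorphic W W'' := by
  obtain ⟨C, rfl⟩ := h
  obtain ⟨C', rfl⟩ := h'
  exact ⟨C' * C, mul_smul C' C W⟩

/-- Isomorphism over `ℚ` as an equivalence relation on elliptic curves. -/
instance isoSetoid : Setoid EllipticCurveQ where
  r E E' := IsIsomorphic E.1 E'.1
  iseqv := ⟨fun E => .refl E.1, fun h => h.symm, fun h h' => h.trans h'⟩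

/-- The curve `y² = x³ + A x + B`. -/
def shortCurve {R : Type*} [CommRing R] (A B : R) : WeierstrassCurve R := ⟨0, 0, 0, A, B⟩

/-! ### The naive height -/

/-- `y² = x³ + A x + B`, with `A` and `B` integers such that `gcd(A³, B²)` is not divisible by the
twelfth power of an integer `k > 1`, is a minimal Weierstrass equation of `W`. -/
def IsMinimalEquation (W : WeierstrassCurve ℚ) (A B : ℤ) : Prop :=
  IsIsomorphic W (shortCurve (A : ℚ) (B : ℚ)) ∧
    ∀ k : ℕ, 1 < k → ¬ k ^ 12 ∣ Int.gcd (A ^ 3) (B ^ 2)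

/-- Scaling a short equation by a nonzero rational number gives an isomorphic curve. -/
theorem isIsomorphic_scale (u : ℚ) (hu : u ≠ 0) (A B : ℚ) :
    IsIsomorphic (shortCurve (u ^ 4 * A) (u ^ 6 * B)) (shortCurve A B) := by
  refine ⟨⟨Units.mk0 u hu, 0, 0, 0⟩, ?_⟩
  ext <;> simp [shortCurve, WeierstrassCurve.variableChange_a₁, WeierstrassCurve.variableChange_a₂,
    WeierstrassCurve.variableChange_a₃, WeierstrassCurve.variableChange_a₄,
    WeierstrassCurve.variableChange_a₆] <;> field_simp

theorem scale_of_isIsomorphic {A B A' B' : ℚ}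
    (h : IsIsomorphic (shortCurve A B) (shortCurve A' B')) :
    ∃ u : ℚ, u ≠ 0 ∧ A = u ^ 4 * A' ∧ B = u ^ 6 * B' := by
  obtain ⟨⟨u, r, s, t⟩, h⟩ := h
  have hu : (u : ℚ) ≠ 0 := u.ne_zero
  have h1 := congrArg WeierstrassCurve.a₁ h
  have h2 := congrArg WeierstrassCurve.a₂ h
  have h3 := congrArg WeierstrassCurve.a₃ h
  have h4 := congrArg WeierstrassCurve.a₄ h
  have h6 := congrArg WeierstrassCurve.a₆ h
  simp only [shortCurve, WeierstrassCurve.variableChange_a₁, WeierstrassCurve.variableChange_a₂,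
    WeierstrassCurve.variableChange_a₃, WeierstrassCurve.variableChange_a₄,
    WeierstrassCurve.variableChange_a₆, Units.val_inv_eq_inv_val] at h1 h2 h3 h4 h6
  field_simp at h1 h2 h3 h4 h6
  have hs : s = 0 := by linarith
  subst hs
  have hr : r = 0 := by linarith
  subst hr
  have ht : t = 0 := by linarith
  subst ht
  exact ⟨u, hu, by linarith, by linarith⟩

theorem shortCurve_ne_zero {E : EllipticCurveQ} {A B : ℚ}
    (h : IsIsomorphic E.1 (shortCurve A B)) : ¬ (A = 0 ∧ B = 0) := by
  rintro ⟨rfl, rfl⟩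
  obtain ⟨C, h⟩ := h
  have hE : (C • E.1).IsElliptic := inferInstance
  rw [h] at hE
  have := hE.isUnit
  simp [shortCurve, WeierstrassCurve.Δ, WeierstrassCurve.b₂, WeierstrassCurve.b₄,
    WeierstrassCurve.b₆, WeierstrassCurve.b₈] at this

theorem exists_integral_equation (E : EllipticCurveQ) :
    ∃ A B : ℤ, IsIsomorphic E.1 (shortCurve (A : ℚ) (B : ℚ)) := by
  obtain ⟨C, hC⟩ := E.1.exists_variableChange_isShortNF
  have h : IsIsomorphic E.1 (shortCurve (C • E.1).a₄ (C • E.1).a₆) := by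
    refine ⟨C, ?_⟩
    ext
    · exact (C • E.1).a₁_of_isShortNF
    · exact (C • E.1).a₂_of_isShortNF
    · exact (C • E.1).a₃_of_isShortNF
    · rfl
    · rfl
  generalize (C • E.1).a₄ = a at h
  generalize (C • E.1).a₆ = b at h
  have ha : (a.den : ℚ) ≠ 0 := by exact_mod_cast a.den_nz
  have hb : (b.den : ℚ) ≠ 0 := by exact_mod_cast b.den_nz
  have hea : a * a.den = a.num := Rat.mul_den_eq_num a
  have heb : b * b.den = b.num := Rat.mul_den_eq_num b
  refine ⟨a.num * a.den ^ 3 * b.den ^ 4, b.num * b.den ^ 5 * a.den ^ 6, h.trans ?_⟩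
  have := (isIsomorphic_scale (a.den * b.den) (mul_ne_zero ha hb) a b).symm
  convert this using 2
  · push_cast
    rw [← hea]
    ring
  · push_cast
    rw [← heb]
    ring

theorem exists_minimalEquation (E : EllipticCurveQ) :
    ∃ A B : ℤ, IsMinimalEquation E.1 A B := by
  obtain ⟨A₀, B₀, h₀⟩ := exists_integral_equation E
  obtain ⟨n, hn⟩ : ∃ n : ℕ, n = A₀.natAbs + B₀.natAbs := ⟨_, rfl⟩
  induction n using Nat.strong_induction_on generalizing A₀ B₀ with
  | _ n ih =>
    by_cases hm : ∀ k : ℕ, 1 < k → ¬ k ^ 12 ∣ Int.gcd (A₀ ^ 3) (B₀ ^ 2)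
    · exact ⟨A₀, B₀, h₀, hm⟩
    · push Not at hm
      obtain ⟨k, hk, hd⟩ := hm
      have hd' : ((k : ℤ) ^ 12) ∣ (Int.gcd (A₀ ^ 3) (B₀ ^ 2) : ℤ) := by exact_mod_cast hd
      have hA : (k : ℤ) ^ 4 ∣ A₀ := by
        rw [← Int.pow_dvd_pow_iff (n := 3) (by norm_num), ← pow_mul]
        exact hd'.trans (Int.gcd_dvd_left ..)
      have hB : (k : ℤ) ^ 6 ∣ B₀ := by
        rw [← Int.pow_dvd_pow_iff (n := 2) (by norm_num), ← pow_mul]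
        exact hd'.trans (Int.gcd_dvd_right ..)
      obtain ⟨A, rfl⟩ := hA
      obtain ⟨B, rfl⟩ := hB
      have hk0 : (k : ℚ) ≠ 0 := by
        have : k ≠ 0 := by omega
        exact_mod_cast this
      have hiso : IsIsomorphic E.1 (shortCurve (A : ℚ) (B : ℚ)) := by
        refine h₀.trans ?_
        have := isIsomorphic_scale k hk0 A B
        push_cast
        exact this
      refine ih _ ?_ A B hiso rfl
      have hne := shortCurve_ne_zero hiso
      rw [hn]
      simp only [Int.natAbs_mul, Int.natAbs_pow, Int.natAbs_natCast]
      have h4 : 1 < k ^ 4 := Nat.one_lt_pow (by norm_num) hk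
      have h6 : 1 < k ^ 6 := Nat.one_lt_pow (by norm_num) hk
      rcases Nat.eq_zero_or_pos A.natAbs with hA | hA
      · have hB : 0 < B.natAbs := by
          rcases Nat.eq_zero_or_pos B.natAbs with hB | hB
          · exact absurd ⟨by simpa using hA, by simpa using hB⟩ hne
          · exact hB
        nlinarith
      · nlinarith [Nat.zero_le B.natAbs]

theorem minimalEquation_unique {W : WeierstrassCurve ℚ} {A B A' B' : ℤ}
    (h : IsMinimalEquation W A B) (h' : IsMinimalEquation W A' B') : A = A' ∧ B = B' := by
  obtain ⟨u, hu, hA, hB⟩ := scale_of_isIsomorphic (h.1.symm.trans h'.1)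
  have hden : (u.den : ℚ) ≠ 0 := by exact_mod_cast u.den_nz
  have hud : u * u.den = u.num := Rat.mul_den_eq_num u
  have eA : A * (u.den : ℤ) ^ 4 = u.num ^ 4 * A' := by
    have : (A : ℚ) * (u.den : ℚ) ^ 4 = (u.num : ℚ) ^ 4 * A' := by
      rw [hA, ← hud]; ring
    exact_mod_cast this
  have eB : B * (u.den : ℤ) ^ 6 = u.num ^ 6 * B' := by
    have : (B : ℚ) * (u.den : ℚ) ^ 6 = (u.num : ℚ) ^ 6 * B' := by
      rw [hB, ← hud]; ring
    exact_mod_cast this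
  have hcop : IsCoprime u.num (u.den : ℤ) := Rat.isCoprime_num_den u
  have key : ∀ (k : ℤ) (a b : ℤ), k ≠ 0 → k ^ 4 ∣ a → k ^ 6 ∣ b →
      (∀ k : ℕ, 1 < k → ¬ k ^ 12 ∣ Int.gcd (a ^ 3) (b ^ 2)) → k.natAbs = 1 := by
    intro k a b hk ha hb hm
    by_contra hne
    have h1 : 1 < k.natAbs := by omega
    refine hm _ h1 (Int.natCast_dvd_natCast.1 ?_)
    push_cast
    have hab : |k| ^ 12 = k ^ 12 := by rw [Even.pow_abs (by decide)]
    rw [hab]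
    refine Int.dvd_coe_gcd ?_ ?_
    · simpa [← pow_mul] using pow_dvd_pow_of_dvd ha 3
    · simpa [← pow_mul] using pow_dvd_pow_of_dvd hb 2
  have hnum : u.num.natAbs = 1 := by
    refine key _ A B (by simpa using hu) ?_ ?_ h.2
    · exact (hcop.pow (m := 4) (n := 4)).dvd_of_dvd_mul_right ⟨A', eA⟩
    · exact (hcop.pow (m := 6) (n := 6)).dvd_of_dvd_mul_right ⟨B', eB⟩
  have hdn : (u.den : ℤ).natAbs = 1 := by
    refine key _ A' B' (by exact_mod_cast u.den_nz) ?_ ?_ h'.2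
    · exact (hcop.symm.pow (m := 4) (n := 4)).dvd_of_dvd_mul_left ⟨A, by rw [← eA]; ring⟩
    · exact (hcop.symm.pow (m := 6) (n := 6)).dvd_of_dvd_mul_left ⟨B, by rw [← eB]; ring⟩
  have hd1 : (u.den : ℤ) = 1 := by omega
  rw [hd1] at eA eB
  rcases Int.natAbs_eq u.num with h1 | h1 <;> rw [hnum] at h1 <;> rw [h1] at eA eB <;>
    norm_num at eA eB <;> exact ⟨eA, eB⟩

/-- Every elliptic curve over `ℚ` has exactly one minimal equation `y² = x³ + A x + B`. -/
theorem existsUnique_minimalEquation (E : EllipticCurveQ) :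
    ∃! p : ℤ × ℤ, IsMinimalEquation E.1 p.1 p.2 := by
  obtain ⟨A, B, h⟩ := exists_minimalEquation E
  refine ⟨(A, B), h, ?_⟩
  rintro ⟨A', B'⟩ h'
  obtain ⟨h1, h2⟩ := minimalEquation_unique h' h
  exact Prod.ext h1 h2

/-- The coefficients `(A, B)` of the minimal equation `y² = x³ + A x + B` of `E`. -/
noncomputable def minimalCoeffs (E : EllipticCurveQ) : ℤ × ℤ :=
  (existsUnique_minimalEquation E).choose

/-- The naive height `max {|A|³, |B|²}`, where `y² = x³ + A x + B` is the minimal equation. -/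
noncomputable def naiveHeight (E : EllipticCurveQ) : ℤ :=
  max (|(minimalCoeffs E).1| ^ 3) (|(minimalCoeffs E).2| ^ 2)

/-! ### Isogenies -/

section Isogeny

variable {K : Type*} [Field K]

/-- Homogeneous coordinates `[X : Y : Z]` of a point of a Weierstrass curve. -/
def homogCoords {W : WeierstrassCurve K} : W.toAffine.Point → Fin 3 → K
  | .zero => ![0, 1, 0]
  | .some x y _ => ![x, y, 1]

/-- A map between the sets of points of two elliptic curves over an algebraically closed field is a
morphism of projective curves if around each point `P` it is given by three homogeneous
polynomials of the same degree. -/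
def IsMorphism {W W' : WeierstrassCurve K} (φ : W.toAffine.Point → W'.toAffine.Point) : Prop :=
  ∀ P : W.toAffine.Point, ∃ (d : ℕ) (F : Fin 3 → MvPolynomial (Fin 3) K),
    (∀ i, (F i).IsHomogeneous d) ∧
    (∃ i, MvPolynomial.eval (homogCoords P) (F i) ≠ 0) ∧
    ∀ Q : W.toAffine.Point, (∃ i, MvPolynomial.eval (homogCoords Q) (F i) ≠ 0) →
      ∃ c : K, c ≠ 0 ∧
        ∀ i, MvPolynomial.eval (homogCoords Q) (F i) = c * homogCoords (φ Q) i

/-- An isogeny is a morphism of curves that takes the origin to the origin. -/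
def IsIsogeny {W W' : WeierstrassCurve K} (φ : W.toAffine.Point → W'.toAffine.Point) : Prop :=
  IsMorphism φ ∧ φ 0 = 0

end Isogeny

/-- The field of algebraic numbers. -/
abbrev QBar : Type := AlgebraicClosure ℚ

open scoped Classical in
/-- The action of the absolute Galois group of `ℚ` on the points of a curve over `ℚ`. -/
noncomputable def galoisAct (W : WeierstrassCurve ℚ) (σ : QBar ≃ₐ[ℚ] QBar)
    (P : (W.baseChange QBar).toAffine.Point) : (W.baseChange QBar).toAffine.Point :=
  WeierstrassCurve.Affine.Point.map (W' := W.toAffine) (σ : QBar →ₐ[ℚ] QBar) P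

open scoped Classical in
/-- `E` has a rational (cyclic) `N`-isogeny: there is an isogeny `φ` from `E` to an elliptic curve
`E'` whose kernel on algebraic points is a cyclic group of order `N` that is stable under the
absolute Galois group of `ℚ`. -/
def HasRationalIsogeny (N : ℕ) (E : EllipticCurveQ) : Prop :=
  ∃ (E' : EllipticCurveQ)
    (φ : (E.1.baseChange QBar).toAffine.Point → (E'.1.baseChange QBar).toAffine.Point),
    IsIsogeny φ ∧
    (∃ C : AddSubgroup (E.1.baseChange QBar).toAffine.Point,
      (∀ P, P ∈ C ↔ φ P = 0) ∧ Nonempty (C ≃+ ZMod N)) ∧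
    ∀ (σ : QBar ≃ₐ[ℚ] QBar) (P), φ P = 0 → φ (galoisAct E.1 σ P) = 0

/-! ### The counting functions -/

/-- The number of isomorphism classes of elliptic curves `E` over `ℚ` with nonzero `j`-invariant,
naive height `< X` and a rational `N`-isogeny. -/
noncomputable def countJNeZero (N : ℕ) (X : ℝ) : ℕ :=
  ((Quotient.mk isoSetoid) '' {E : EllipticCurveQ |
    (naiveHeight E : ℝ) < X ∧ HasRationalIsogeny N E ∧ E.1.j ≠ 0}).ncard

/-- The number of isomorphism classes of elliptic curves `E` over `ℚ` with `j`-invariant zero,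
naive height `< X` and a rational `N`-isogeny. -/
noncomputable def countJEqZero (N : ℕ) (X : ℝ) : ℕ :=
  ((Quotient.mk isoSetoid) '' {E : EllipticCurveQ |
    (naiveHeight E : ℝ) < X ∧ HasRationalIsogeny N E ∧ E.1.j = 0}).ncard

/-! ### The family -/

/-- The quadratic twist `d y² = x³ + A x + B` of `y² = x³ + A x + B`, in the Weierstrass form
`y² = x³ + d² A x + d³ B`. -/
def twistedShortCurve (d A B : ℚ) : WeierstrassCurve ℚ := shortCurve (d ^ 2 * A) (d ^ 3 * B)

/-- The quadratic twist by `d` of `y² = x³ + (2t - 1/3) x + (t² - 2t/3 + 2/27)`. -/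
def familyTwist (d t : ℚ) : WeierstrassCurve ℚ :=
  twistedShortCurve d (2 * t - 1 / 3) (t ^ 2 - 2 / 3 * t + 2 / 27)

end EllipticCount

/-!
An isogeny over `ℚ` with cyclic kernel of order three exists on `E` if and only if the third
division polynomial of `E` has a rational root `x₀` (`hasRationalIsogeny_three_iff`). Given the
isogeny, Galois permutes the two nonzero points `P` and `-P` of the kernel, so their common first
coordinate is rational, and `P + P = -P` makes it a root. Conversely, Vélu's formulas centred at
`x₀` define the quotient by the subgroup generated by the points above `x₀`; after division by `Z`
modulo the equation of the curve they are given by three cubic forms without a common zero on the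
curve (`exists_isogeny_veluCurve`).

For `y² = x³ + A x + B` the division polynomial is `3x⁴ + 6Ax² + 12Bx - A²`. If `A ≠ 0`, a root is
nonzero and translating it to `x = 0` gives `y² = x³ + d (x + m)²`, a twist of a member of the
family. If `A = 0`, then `x = 0` is a root, so every curve with `j = 0` has a rational
three-isogeny, and those of height less than `X` correspond to the integers `B` with
`0 < |B| < X^(1/2)` without sixth-power factors. These include all squarefree numbers, whose density
is positive.

For `A ≠ 0` put `Y = X^(1/6)`, so that `|A| < Y²` and `|B| < Y³`. For integral `A` and `B` the root
`r` is an integer that divides `A²`, it satisfies `|r| ≤ 3Y` and `A² ≤ 111 |r| Y³`, and it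
determines `B` from `A`. With `|r| = s m²`, `s` squarefree, one has `A = s m n` with `s m² ≤ 3Y` and
`s n² ≤ 111 Y³`, and the number of such triples is of order `∑ Y² / m`, that is, `Y² log Y`
(`ncard_isogenyPairs_le`). In the other direction the triples with `s m² ≤ Y / 4` and `n ≤ m Y / 4`
give distinct pairs with root `4 s m²` and `A = 12 s m n`, because a curve with `A > 0` has only one
positive root (`le_ncard_isogenyPairs`). These pairs need not be minimal. Every pair is
`(k⁴ a, k⁶ b)` with `(a, b)` minimal, and by the upper bound those with `k` greater than a large constant `K` make
up at most half of the lower bound; the others come from at most `K` copies of the set of minimal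
pairs (`le_ncard_reducedIsogenyPairs`).
-/

namespace EllipticCount

/-! ### Points of order three -/

section ThreeTorsion

variable {K : Type*} [Field K]

lemma isRoot_Ψ₃_iff (W : WeierstrassCurve K) (x : K) :
    W.Ψ₃.IsRoot x ↔
      3 * x ^ 4 + W.b₂ * x ^ 3 + 3 * W.b₄ * x ^ 2 + 3 * W.b₆ * x + W.b₈ = 0 := by
  simp [Polynomial.IsRoot, WeierstrassCurve.Ψ₃]

/-- For an affine point `P = (x, y)`, the equation `P + P = -P` says that the tangent line at `P`
meets the curve at `P` only, which is the vanishing of the third division polynomial at `x`. -/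
lemma add_self_eq_neg_iff [DecidableEq K] (W : WeierstrassCurve K) {x y : K}
    (h : W.toAffine.Nonsingular x y) (hy : y ≠ W.toAffine.negY x y) :
    (WeierstrassCurve.Affine.Point.some x y h + .some x y h = -.some x y h) ↔
      W.Ψ₃.IsRoot x := by
  have heq := (WeierstrassCurve.Affine.equation_iff _ _).1 h.1
  have hd : y - W.toAffine.negY x y ≠ 0 := sub_ne_zero.2 hy
  have key : W.toAffine.addX x x (W.toAffine.slope x x y y) = x ↔ W.Ψ₃.IsRoot x := by
    rw [isRoot_Ψ₃_iff, WeierstrassCurve.Affine.slope_of_Y_ne rfl hy,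
      WeierstrassCurve.Affine.addX, ← sub_eq_zero, div_pow]
    have hd2 := pow_ne_zero 2 hd
    rw [← mul_right_inj' hd2, mul_zero]
    have e : (y - W.toAffine.negY x y) ^ 2 *
        ((3 * x ^ 2 + 2 * W.a₂ * x + W.a₄ - W.a₁ * y) ^ 2 / (y - W.toAffine.negY x y) ^ 2 +
        W.a₁ * ((3 * x ^ 2 + 2 * W.a₂ * x + W.a₄ - W.a₁ * y) / (y - W.toAffine.negY x y)) -
        W.a₂ - x - x - x) =
        -(3 * x ^ 4 + W.b₂ * x ^ 3 + 3 * W.b₄ * x ^ 2 + 3 * W.b₆ * x + W.b₈) := by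
      field_simp
      simp only [WeierstrassCurve.Affine.negY, WeierstrassCurve.b₂, WeierstrassCurve.b₄,
        WeierstrassCurve.b₆, WeierstrassCurve.b₈]
      linear_combination (-W.a₁ ^ 2 - 4 * (W.a₂ + 3 * x)) * heq
    rw [e, neg_eq_zero]
  rw [← key, WeierstrassCurve.Affine.Point.add_self_of_Y_ne hy,
    WeierstrassCurve.Affine.Point.neg_some, WeierstrassCurve.Affine.Point.some.injEq]
  refine ⟨fun H => H.1, fun H => ⟨H, ?_⟩⟩
  rw [WeierstrassCurve.Affine.addY, WeierstrassCurve.Affine.negAddY, H, sub_self, mul_zero,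
    zero_add]

end ThreeTorsion

/-! ### The isogeny with a given kernel of order three -/

section Velu

variable {K : Type*} [Field K]

/-- The quadratic coefficient of the cubic `f` in the model `Y² = f(X)` of `W` in which
`X = x - x₀` and `Y = y + (a₁ x + a₃) / 2`. -/
def shiftA (W : WeierstrassCurve K) (x₀ : K) : K := W.b₂ / 4 + 3 * x₀

/-- The linear coefficient of the cubic in the model of `W` centred at `x₀`. -/
def shiftB (W : WeierstrassCurve K) (x₀ : K) : K := W.b₂ * x₀ / 2 + 3 * x₀ ^ 2 + W.b₄ / 2

/-- The constant coefficient of the cubic in the model of `W` centred at `x₀`. -/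
def shiftC (W : WeierstrassCurve K) (x₀ : K) : K :=
  x₀ ^ 3 + W.b₂ * x₀ ^ 2 / 4 + W.b₄ * x₀ / 2 + W.b₆ / 4

/-- Vélu's equation of the quotient of `W` by the subgroup of order three formed by the origin and
the two points with first coordinate `x₀`. -/
def veluCurve (W : WeierstrassCurve K) (x₀ : K) : WeierstrassCurve K :=
  ⟨0, shiftA W x₀, 0, -9 * shiftB W x₀, -27 * shiftC W x₀ - 8 * shiftA W x₀ * shiftB W x₀⟩

variable [CharZero K]

lemma shiftB_sq {W : WeierstrassCurve K} {x₀ : K} (h : W.Ψ₃.IsRoot x₀) :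
    shiftB W x₀ ^ 2 = 4 * shiftA W x₀ * shiftC W x₀ := by
  rw [isRoot_Ψ₃_iff] at h
  have h8 := W.b_relation
  simp only [shiftA, shiftB, shiftC]
  linear_combination -h + h8 / 4

/-- With `b² = 4ac`, the discriminant `16 (a²b² - 4b³ - 4a³c - 27c² + 18abc)` of
`Y² = X³ + aX² + bX + c` factors. -/
lemma Δ_eq_of_isRoot {W : WeierstrassCurve K} {x₀ : K} (h : W.Ψ₃.IsRoot x₀) :
    W.Δ = 16 * shiftC W x₀ * (2 * shiftA W x₀ * shiftB W x₀ - 27 * shiftC W x₀) := by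
  have h1 := shiftB_sq h
  have h8 := W.b_relation
  have h2 : W.Δ = 16 * (shiftA W x₀ ^ 2 * shiftB W x₀ ^ 2 - 4 * shiftB W x₀ ^ 3 -
      4 * shiftA W x₀ ^ 3 * shiftC W x₀ - 27 * shiftC W x₀ ^ 2 +
      18 * shiftA W x₀ * shiftB W x₀ * shiftC W x₀) := by
    simp only [shiftA, shiftB, shiftC, WeierstrassCurve.Δ]
    linear_combination (-W.b₂ ^ 2 / 4) * h8
  rw [h2]
  linear_combination (16 * shiftA W x₀ ^ 2 - 64 * shiftB W x₀) * h1

lemma shiftC_mul_Δ_veluCurve {W : WeierstrassCurve K} {x₀ : K} (h : W.Ψ₃.IsRoot x₀) :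
    shiftC W x₀ * (veluCurve W x₀).Δ =
      16 * (2 * shiftA W x₀ * shiftB W x₀ - 27 * shiftC W x₀) ^ 3 := by
  have h1 := shiftB_sq h
  simp only [veluCurve, WeierstrassCurve.Δ, WeierstrassCurve.b₂, WeierstrassCurve.b₄,
    WeierstrassCurve.b₆, WeierstrassCurve.b₈]
  generalize shiftA W x₀ = a at *
  generalize shiftB W x₀ = b at *
  generalize shiftC W x₀ = c at *
  grind

lemma shiftC_ne_zero {W : WeierstrassCurve K} [W.IsElliptic] {x₀ : K} (h : W.Ψ₃.IsRoot x₀) :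
    shiftC W x₀ ≠ 0 := by
  intro hc
  apply (W.coe_Δ' ▸ W.Δ'.ne_zero : W.Δ ≠ 0)
  rw [Δ_eq_of_isRoot h, hc]
  ring

lemma Δ_veluCurve_ne_zero {W : WeierstrassCurve K} [W.IsElliptic] {x₀ : K}
    (h : W.Ψ₃.IsRoot x₀) : (veluCurve W x₀).Δ ≠ 0 := by
  have hΔ : W.Δ ≠ 0 := W.coe_Δ' ▸ W.Δ'.ne_zero
  rw [Δ_eq_of_isRoot h] at hΔ
  intro h0
  have := shiftC_mul_Δ_veluCurve h
  rw [h0, mul_zero] at this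
  have h3 : 2 * shiftA W x₀ * shiftB W x₀ - 27 * shiftC W x₀ = 0 := by
    simpa using this.symm
  simp [h3] at hΔ

lemma equation_shift {W : WeierstrassCurve K} {x y : K} (x₀ : K) (h : W.toAffine.Equation x y) :
    (y + (W.a₁ * x + W.a₃) / 2) ^ 2 = (x - x₀) ^ 3 + shiftA W x₀ * (x - x₀) ^ 2 +
      shiftB W x₀ * (x - x₀) + shiftC W x₀ := by
  have heq := (WeierstrassCurve.Affine.equation_iff _ _).1 h
  simp only [shiftA, shiftB, shiftC, WeierstrassCurve.b₂, WeierstrassCurve.b₄,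
    WeierstrassCurve.b₆]
  linear_combination heq

lemma equation_veluCurve {W : WeierstrassCurve K} {x₀ : K} (h : W.Ψ₃.IsRoot x₀) {u v : K}
    (hu : u ≠ 0)
    (he : v ^ 2 = u ^ 3 + shiftA W x₀ * u ^ 2 + shiftB W x₀ * u + shiftC W x₀) :
    (veluCurve W x₀).toAffine.Equation ((u ^ 3 + 2 * shiftB W x₀ * u + 4 * shiftC W x₀) / u ^ 2)
      (v * (u ^ 3 - 2 * shiftB W x₀ * u - 8 * shiftC W x₀) / u ^ 3) := by
  have h1 := shiftB_sq h
  rw [WeierstrassCurve.Affine.equation_iff]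
  simp only [veluCurve]
  generalize shiftA W x₀ = a at *
  generalize shiftB W x₀ = b at *
  generalize shiftC W x₀ = c at *
  field_simp
  grind

end Velu
section ThreeIsogeny

open WeierstrassCurve.Affine MvPolynomial

variable {K : Type*} [Field K]

/-- The form of degree three that agrees on the curve with `(X - x₀ Z)³ / Z`. -/
noncomputable def cubeForm (W : WeierstrassCurve K) (x₀ : K) : MvPolynomial (Fin 3) K :=
  (X 1 + C (W.a₁ / 2) * X 0 + C (W.a₃ / 2) * X 2) ^ 2 -
    C (shiftA W x₀) * (X 0 - C x₀ * X 2) ^ 2 -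
    C (shiftB W x₀) * ((X 0 - C x₀ * X 2) * X 2) - C (shiftC W x₀) * X 2 ^ 2

/-- Cubic forms that define Vélu's isogeny at every point of the curve. -/
noncomputable def isogenyForm (W : WeierstrassCurve K) (x₀ : K) :
    Fin 3 → MvPolynomial (Fin 3) K :=
  ![(X 0 - C x₀ * X 2) * (cubeForm W x₀ + C (2 * shiftB W x₀) * ((X 0 - C x₀ * X 2) * X 2) +
      C (4 * shiftC W x₀) * X 2 ^ 2),
    (X 1 + C (W.a₁ / 2) * X 0 + C (W.a₃ / 2) * X 2) * (cubeForm W x₀ -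
      C (2 * shiftB W x₀) * ((X 0 - C x₀ * X 2) * X 2) - C (8 * shiftC W x₀) * X 2 ^ 2),
    X 2 * cubeForm W x₀]

lemma isHomogeneous_isogenyForm (W : WeierstrassCurve K) (x₀ : K) (i : Fin 3) :
    (isogenyForm W x₀ i).IsHomogeneous 3 := by
  have hX (j : Fin 3) : (X j : MvPolynomial (Fin 3) K).IsHomogeneous 1 := isHomogeneous_X _ _
  have hC {p : MvPolynomial (Fin 3) K} {n : ℕ} (c : K) (hp : p.IsHomogeneous n) :
      (C c * p).IsHomogeneous n := by simpa using (isHomogeneous_C _ c).mul hp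
  have hu : (X 0 - C x₀ * X 2 : MvPolynomial (Fin 3) K).IsHomogeneous 1 :=
    (hX 0).sub (hC _ (hX 2))
  have hv : (X 1 + C (W.a₁ / 2) * X 0 + C (W.a₃ / 2) * X 2 :
      MvPolynomial (Fin 3) K).IsHomogeneous 1 :=
    ((hX 1).add (hC _ (hX 0))).add (hC _ (hX 2))
  have hw : (cubeForm W x₀).IsHomogeneous 2 :=
    (((hv.pow 2).sub (hC _ (hu.pow 2))).sub (hC _ (hu.mul (hX 2)))).sub (hC _ ((hX 2).pow 2))
  fin_cases i
  · exact hu.mul ((hw.add (hC _ (hu.mul (hX 2)))).add (hC _ ((hX 2).pow 2)))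
  · exact hv.mul ((hw.sub (hC _ (hu.mul (hX 2)))).sub (hC _ ((hX 2).pow 2)))
  · exact (hX 2).mul hw

lemma eval_isogenyForm_zero (W : WeierstrassCurve K) (x₀ : K) (i : Fin 3) :
    eval ![0, 1, 0] (isogenyForm W x₀ i) = (![0, 1, 0] : Fin 3 → K) i := by
  fin_cases i <;> simp [isogenyForm, cubeForm]

variable [CharZero K]

lemma eval_isogenyForm_some {W : WeierstrassCurve K} {x y : K} (x₀ : K)
    (h : W.toAffine.Equation x y) (i : Fin 3) :
    eval ![x, y, 1] (isogenyForm W x₀ i) =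
      (![(x - x₀) * ((x - x₀) ^ 3 + 2 * shiftB W x₀ * (x - x₀) + 4 * shiftC W x₀),
        (y + (W.a₁ * x + W.a₃) / 2) *
          ((x - x₀) ^ 3 - 2 * shiftB W x₀ * (x - x₀) - 8 * shiftC W x₀),
        (x - x₀) ^ 3] : Fin 3 → K) i := by
  have he := equation_shift x₀ h
  have hw : eval ![x, y, 1] (cubeForm W x₀) = (x - x₀) ^ 3 := by
    simp [cubeForm]
    linear_combination he
  fin_cases i <;> simp [isogenyForm, hw, -mul_eq_mul_left_iff, -mul_eq_mul_right_iff]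
  ring

/-- Vélu's isogeny of degree three over a field of characteristic zero. -/
theorem exists_isogeny_veluCurve (W : WeierstrassCurve K) [W.IsElliptic] {x₀ : K}
    (h : W.Ψ₃.IsRoot x₀) :
    ∃ φ : W.toAffine.Point → (veluCurve W x₀).toAffine.Point, IsIsogeny φ ∧
      ∀ x y hxy, φ (.some x y hxy) = 0 ↔ x = x₀ := by
  classical
  have hc := shiftC_ne_zero h
  have hns {x y : K} (hxy : W.toAffine.Nonsingular x y) (hx : x ≠ x₀) :=
    (equation_iff_nonsingular_of_Δ_ne_zero (Δ_veluCurve_ne_zero h)).1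
      (equation_veluCurve h (sub_ne_zero.2 hx) (equation_shift x₀ hxy.1))
  let φ : W.toAffine.Point → (veluCurve W x₀).toAffine.Point
    | .zero => 0
    | .some x y hxy => if hx : x = x₀ then 0 else .some _ _ (hns hxy hx)
  have hφ {x y : K} (hxy : W.toAffine.Nonsingular x y) (hx : x ≠ x₀) :
      φ (.some x y hxy) = .some _ _ (hns hxy hx) := dif_neg hx
  have hφ₀ {x y : K} (hxy : W.toAffine.Nonsingular x y) (hx : x = x₀) :
      φ (.some x y hxy) = 0 := dif_pos hx
  -- The forms have no common zero on the curve, so they represent `φ` at all points at once.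
  have hform (Q : W.toAffine.Point) : ∃ c : K, c ≠ 0 ∧
      ∀ i, eval (homogCoords Q) (isogenyForm W x₀ i) = c * homogCoords (φ Q) i := by
    rcases Q with _ | ⟨x, y, hxy⟩
    · exact ⟨1, one_ne_zero, fun i => by
        rw [one_mul]; exact eval_isogenyForm_zero W x₀ i⟩
    · have he := equation_shift x₀ hxy.1
      by_cases hx : x = x₀
      · refine ⟨(y + (W.a₁ * x + W.a₃) / 2) * (-8 * shiftC W x₀), ?_, fun i => ?_⟩
        · have hy : (y + (W.a₁ * x + W.a₃) / 2) ^ 2 ≠ 0 := by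
            rw [he, hx]
            simpa using hc
          exact mul_ne_zero (by simpa using hy) (mul_ne_zero (by norm_num) hc)
        · rw [hφ₀ hxy hx]
          refine (eval_isogenyForm_some x₀ hxy.1 i).trans ?_
          change _ = _ * (![0, 1, 0] : Fin 3 → K) i
          fin_cases i <;> simp [hx]
      · have hx' := sub_ne_zero.2 hx
        refine ⟨(x - x₀) ^ 3, pow_ne_zero 3 hx', fun i => ?_⟩
        rw [hφ hxy hx]
        refine (eval_isogenyForm_some x₀ hxy.1 i).trans ?_
        change _ = _ * (![_, _, 1] : Fin 3 → K) i
        fin_cases i <;> simp <;> field_simp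
  have hne (Q : (veluCurve W x₀).toAffine.Point) : ∃ i, homogCoords Q i ≠ 0 := by
    rcases Q with _ | ⟨x, y, hxy⟩
    · exact ⟨1, by simp [homogCoords]⟩
    · exact ⟨2, by simp [homogCoords]⟩
  refine ⟨φ, ⟨fun P => ⟨3, isogenyForm W x₀, isHomogeneous_isogenyForm W x₀, ?_,
    fun Q _ => hform Q⟩, rfl⟩, fun x y hxy => ?_⟩
  · obtain ⟨c, hc0, hcP⟩ := hform P
    obtain ⟨i, hi⟩ := hne (φ P)
    exact ⟨i, by rw [hcP]; exact mul_ne_zero hc0 hi⟩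
  · by_cases hx : x = x₀
    · exact iff_of_true (hφ₀ hxy hx) hx
    · exact iff_of_false (by rw [hφ hxy hx]; exact Point.some_ne_zero _) hx

end ThreeIsogeny
/-! ### Rational isogenies of degree three -/

section Kernel

open WeierstrassCurve.Affine

variable {K : Type*} [Field K]

/-- Over an algebraically closed field, a root of the third division polynomial is the first
coordinate of a point that generates a subgroup of order three. -/
lemma exists_zmultiples_of_isRoot [CharZero K] [IsAlgClosed K] [DecidableEq K]
    (W : WeierstrassCurve K) [W.IsElliptic] {x₀ : K} (h : W.Ψ₃.IsRoot x₀) :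
    ∃ P : W.toAffine.Point, addOrderOf P = 3 ∧
      ∀ Q, Q ∈ AddSubgroup.zmultiples P ↔ Q = 0 ∨ ∃ y hy, Q = .some x₀ y hy := by
  obtain ⟨v, hv⟩ := IsAlgClosed.exists_pow_nat_eq (shiftC W x₀) (n := 2) (by norm_num)
  have hv0 : v ≠ 0 := by
    rintro rfl
    exact shiftC_ne_zero h (by simpa using hv.symm)
  obtain ⟨y, hy⟩ : ∃ y, y = v - (W.a₁ * x₀ + W.a₃) / 2 := ⟨_, rfl⟩
  have heq : W.toAffine.Equation x₀ y := by
    rw [equation_iff, hy]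
    simp only [shiftC, WeierstrassCurve.b₂, WeierstrassCurve.b₄, WeierstrassCurve.b₆] at hv
    linear_combination hv
  have hns := equation_iff_nonsingular.1 heq
  have hneg : y ≠ W.toAffine.negY x₀ y := by
    intro h0
    apply hv0
    rw [negY, hy] at h0
    linear_combination h0 / 2
  obtain ⟨P, hP⟩ : ∃ P : W.toAffine.Point, P = .some x₀ y hns := ⟨_, rfl⟩
  have h2 : P + P = -P := by rw [hP]; exact (add_self_eq_neg_iff W hns hneg).2 h
  have h3 : 3 • P = 0 := by
    rw [show (3 : ℕ) = 2 + 1 from rfl, add_smul, two_nsmul, one_nsmul, h2, neg_add_cancel]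
  have hP0 : P ≠ 0 := by rw [hP]; exact Point.some_ne_zero _
  have hord : addOrderOf P = 3 := addOrderOf_eq_prime h3 hP0
  refine ⟨P, hord, fun Q => ⟨fun hQ => ?_, ?_⟩⟩
  · rw [IsOfFinAddOrder.mem_zmultiples_iff_mem_range_addOrderOf
      (addOrderOf_pos_iff.1 (by rw [hord]; norm_num)), hord] at hQ
    simp only [Finset.mem_image, Finset.mem_range] at hQ
    obtain ⟨n, hn, rfl⟩ := hQ
    interval_cases n
    · left; simp
    · right; exact ⟨y, hns, by simp [hP]⟩
    · right
      have h := (two_nsmul P).trans h2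
      rw [hP, Point.neg_some, ← hP] at h
      exact ⟨_, _, h⟩
  · rintro (rfl | ⟨y', hy', rfl⟩)
    · exact zero_mem _
    · rcases Point.X_eq_iff (h₁ := hy') (h₂ := hns) |>.1 rfl with h | h <;> rw [h, ← hP]
      · exact AddSubgroup.mem_zmultiples P
      · exact neg_mem (AddSubgroup.mem_zmultiples P)

end Kernel

lemma baseChange_veluCurve (W : WeierstrassCurve ℚ) (x₀ : ℚ) :
    (veluCurve W x₀).baseChange QBar = veluCurve (W.baseChange QBar) (algebraMap ℚ QBar x₀) := by
  ext <;> simp [veluCurve, shiftA, shiftB, shiftC, WeierstrassCurve.baseChange,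
    WeierstrassCurve.map_b₂, WeierstrassCurve.map_b₄, WeierstrassCurve.map_b₆]

instance isGalois_QBar : IsGalois ℚ QBar := by
  -- The canonical `ℚ`-algebra structure of `QBar` is not syntactically that of an
  -- algebraic closure.
  have h : Algebra.IsAlgebraic ℚ QBar := by
    convert AlgebraicClosure.isAlgebraic ℚ
    · rfl
    · exact Subsingleton.elim (α := Algebra ℚ QBar) _ _
  have : IsAlgClosure ℚ QBar := ⟨inferInstance, h⟩
  exact IsAlgClosure.isGalois ℚ QBar

/-- An isogeny over `ℚ` with kernel of order three amounts to a rational root of the third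
division polynomial: the two nonzero points of the kernel differ by a sign, so Galois fixes their
first coordinate. -/
theorem hasRationalIsogeny_three_iff (E : EllipticCurveQ) :
    HasRationalIsogeny 3 E ↔ ∃ x : ℚ, E.1.Ψ₃.IsRoot x := by
  classical
  constructor
  · rintro ⟨E', φ, -, ⟨C, hC, ⟨e⟩⟩, hσ⟩
    obtain ⟨P, hP⟩ : ∃ P : C, P = e.symm 1 := ⟨_, rfl⟩
    have hC3 (Q : C) : 3 • Q = 0 := by
      apply e.injective
      rw [map_nsmul, map_zero, nsmul_eq_mul]
      exact (congrArg (· * e Q) (ZMod.natCast_self 3)).trans (zero_mul _)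
    have hP0 : (P : (E.1.baseChange QBar).toAffine.Point) ≠ 0 := by
      intro h
      have : P = 0 := Subtype.ext h
      rw [hP, map_eq_zero_iff _ e.symm.injective] at this
      exact absurd this (by decide)
    have h2 (Q : (E.1.baseChange QBar).toAffine.Point) (hQ : Q ∈ C) : Q + Q = -Q := by
      have := congrArg Subtype.val (hC3 ⟨Q, hQ⟩)
      rw [← add_eq_zero_iff_eq_neg, ← two_nsmul, ← succ_nsmul]
      exact this
    have hmem (Q : (E.1.baseChange QBar).toAffine.Point) (hQ : Q ∈ C) : Q = 0 ∨ Q = P ∨ Q = -P := by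
      have h3 : ∀ z : ZMod 3, z = 0 ∨ z = 1 ∨ z = -1 := by decide
      rcases h3 (e ⟨Q, hQ⟩) with h | h | h
      · left
        have := congrArg e.symm h
        simpa using this
      · right; left
        have := congrArg e.symm h
        rw [e.symm_apply_apply, ← hP] at this
        exact congrArg Subtype.val this
      · right; right
        have := congrArg e.symm h
        rw [e.symm_apply_apply, map_neg, ← hP] at this
        exact congrArg Subtype.val this
    have hPC := P.2
    generalize (P : (E.1.baseChange QBar).toAffine.Point) = R at *
    rcases R with _ | ⟨x, y, hxy⟩
    · exact absurd rfl hP0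
    have hx : ∀ σ : QBar ≃ₐ[ℚ] QBar, σ x = x := by
      intro σ
      have := (hC _).2 (hσ σ _ ((hC _).1 hPC))
      rcases hmem _ this with h | h | h
      · exact absurd h (WeierstrassCurve.Affine.Point.some_ne_zero _)
      · exact (WeierstrassCurve.Affine.Point.some.inj h).1
      · exact (WeierstrassCurve.Affine.Point.some.inj h).1
    obtain ⟨q, hq⟩ := (InfiniteGalois.mem_range_algebraMap_iff_fixed x).2 hx
    refine ⟨q, ?_⟩
    have hy : y ≠ (E.1.baseChange QBar).toAffine.negY x y := by
      intro hy
      have := h2 _ hPC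
      rw [WeierstrassCurve.Affine.Point.add_self_of_Y_eq hy] at this
      exact hP0 (neg_eq_zero.1 this.symm)
    have hroot := (add_self_eq_neg_iff _ hxy hy).1 (h2 _ hPC)
    rw [← hq, WeierstrassCurve.baseChange, WeierstrassCurve.map_Ψ₃] at hroot
    exact hroot.of_map (algebraMap ℚ QBar).injective
  · rintro ⟨x, hx⟩
    have hx' : (E.1.baseChange QBar).Ψ₃.IsRoot (algebraMap ℚ QBar x) := by
      rw [WeierstrassCurve.baseChange, WeierstrassCurve.map_Ψ₃]
      exact hx.map
    have hE' : (veluCurve E.1 x).IsElliptic := ⟨(Δ_veluCurve_ne_zero hx).isUnit⟩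
    have hE : (E.1.baseChange QBar).IsElliptic :=
      inferInstanceAs (E.1.map (algebraMap ℚ QBar)).IsElliptic
    obtain ⟨φ, hφ, hker⟩ : ∃ φ : (E.1.baseChange QBar).toAffine.Point →
        ((veluCurve E.1 x).baseChange QBar).toAffine.Point, IsIsogeny φ ∧
          ∀ u v huv, φ (.some u v huv) = 0 ↔ u = algebraMap ℚ QBar x := by
      rw [baseChange_veluCurve]
      exact exists_isogeny_veluCurve _ hx'
    obtain ⟨P, hP, hmem⟩ := exists_zmultiples_of_isRoot _ hx'
    refine ⟨⟨_, hE'⟩, φ, hφ, ⟨AddSubgroup.zmultiples P, fun Q => ?_, ?_⟩, fun σ Q hQ => ?_⟩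
    · rw [hmem]
      rcases Q with _ | ⟨u, v, huv⟩
      · exact iff_of_true (.inl rfl) hφ.2
      · rw [hker]
        constructor
        · rintro (h | ⟨y, hy, h⟩)
          · exact absurd h (WeierstrassCurve.Affine.Point.some_ne_zero _)
          · exact (WeierstrassCurve.Affine.Point.some.inj h).1
        · rintro rfl
          exact .inr ⟨v, huv, rfl⟩
    · have := zmodAddCyclicAddEquiv (G := AddSubgroup.zmultiples P) inferInstance
      rw [Nat.card_zmultiples, hP] at this
      exact ⟨this.symm⟩
    · rcases Q with _ | ⟨u, v, huv⟩
      · exact hφ.2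
      · rw [hker] at hQ
        refine (hker _ _ _).2 ?_
        rw [hQ]
        exact AlgEquiv.commutes σ x

/-! ### Short equations with a rational three-isogeny -/

lemma exists_isRoot_of_isIsomorphic {W W' : WeierstrassCurve ℚ} (h : IsIsomorphic W W')
    (hW : ∃ x : ℚ, W.Ψ₃.IsRoot x) : ∃ x : ℚ, W'.Ψ₃.IsRoot x := by
  obtain ⟨C, rfl⟩ := h
  obtain ⟨x, hx⟩ := hW
  refine ⟨(C.u⁻¹ : ℚˣ) ^ 2 * (x - C.r), ?_⟩
  rw [isRoot_Ψ₃_iff] at hx ⊢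
  rw [WeierstrassCurve.variableChange_b₂, WeierstrassCurve.variableChange_b₄,
    WeierstrassCurve.variableChange_b₆, WeierstrassCurve.variableChange_b₈]
  linear_combination ((C.u⁻¹ : ℚˣ) : ℚ) ^ 8 * hx

lemma isRoot_Ψ₃_shortCurve {A B x : ℚ} :
    (shortCurve A B).Ψ₃.IsRoot x ↔ 3 * x ^ 4 + 6 * A * x ^ 2 + 12 * B * x = A ^ 2 := by
  rw [isRoot_Ψ₃_iff, ← sub_eq_zero (b := A ^ 2)]
  simp only [shortCurve, WeierstrassCurve.b₂, WeierstrassCurve.b₄, WeierstrassCurve.b₆,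
    WeierstrassCurve.b₈]
  ring_nf

lemma hasRationalIsogeny_three_iff_of_isIsomorphic {E : EllipticCurveQ} {A B : ℚ}
    (h : IsIsomorphic E.1 (shortCurve A B)) :
    HasRationalIsogeny 3 E ↔ ∃ x : ℚ, 3 * x ^ 4 + 6 * A * x ^ 2 + 12 * B * x = A ^ 2 := by
  simp only [hasRationalIsogeny_three_iff, ← isRoot_Ψ₃_shortCurve]
  exact ⟨exists_isRoot_of_isIsomorphic h, exists_isRoot_of_isIsomorphic h.symm⟩

lemma j_eq_zero_iff_of_isIsomorphic {E : EllipticCurveQ} {A B : ℚ}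
    (h : IsIsomorphic E.1 (shortCurve A B)) : E.1.j = 0 ↔ A = 0 := by
  obtain ⟨C, h⟩ := h
  have hj : E.1.j = 0 ↔ (C • E.1).c₄ = 0 := by
    rw [← WeierstrassCurve.variableChange_j E.1 C]
    rw [WeierstrassCurve.j_eq_zero_iff]
  rw [hj, h]
  simp [shortCurve, WeierstrassCurve.c₄, WeierstrassCurve.b₂, WeierstrassCurve.b₄]

/-- Moving the three-torsion point to `x = 0` gives `y² = x³ + d (x + m)²`, the twist by `d` of the
member of the family with `t = m / d`. -/
theorem hasRationalIsogeny_three_iff_familyTwist (E : EllipticCurveQ) (hj : E.1.j ≠ 0) :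
    HasRationalIsogeny 3 E ↔ ∃ d t : ℚ, d ≠ 0 ∧ IsIsomorphic E.1 (familyTwist d t) := by
  constructor
  · intro hE
    obtain ⟨A, B, h⟩ := exists_integral_equation E
    obtain ⟨x, hx⟩ := (hasRationalIsogeny_three_iff_of_isIsomorphic h).1 hE
    have hA := mt (j_eq_zero_iff_of_isIsomorphic h).2 hj
    have hx0 : x ≠ 0 := by
      rintro rfl
      apply hA
      simpa using hx.symm
    refine ⟨3 * x, (3 * x ^ 2 + A) / (18 * x ^ 2), by simpa using hx0, ?_⟩
    convert h using 1
    rw [familyTwist, twistedShortCurve]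
    congr 1
    · field_simp
      ring
    · field_simp
      linear_combination -729 * hx
  · rintro ⟨d, t, -, h⟩
    refine (hasRationalIsogeny_three_iff_of_isIsomorphic h).2 ⟨d / 3, ?_⟩
    ring

/-! ### Counting isomorphism classes by minimal equations -/

lemma isMinimalEquation_minimalCoeffs (E : EllipticCurveQ) :
    IsMinimalEquation E.1 (minimalCoeffs E).1 (minimalCoeffs E).2 :=
  (existsUnique_minimalEquation E).choose_spec.1

lemma minimalCoeffs_eq {E : EllipticCurveQ} {A B : ℤ} (h : IsMinimalEquation E.1 A B) :
    minimalCoeffs E = (A, B) :=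
  Prod.ext_iff.2 (minimalEquation_unique (isMinimalEquation_minimalCoeffs E) h)

/-- The pair `(A, B)` is not of the form `(k⁴ a, k⁶ b)` with an integer `k > 1`; in terms of the
greatest common divisor, as for minimal equations. -/
def IsReducedPair (p : ℤ × ℤ) : Prop :=
  ∀ k : ℕ, 1 < k → ¬ k ^ 12 ∣ Int.gcd (p.1 ^ 3) (p.2 ^ 2)

lemma isReducedPair_iff (p : ℤ × ℤ) :
    IsReducedPair p ↔ ∀ k : ℕ, 1 < k → ¬ ((k : ℤ) ^ 4 ∣ p.1 ∧ (k : ℤ) ^ 6 ∣ p.2) := by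
  refine forall_congr' fun k => forall_congr' fun _ => not_congr ?_
  rw [← Int.natCast_dvd_natCast, Int.dvd_coe_gcd_iff,
    ← Int.pow_dvd_pow_iff (a := (k : ℤ) ^ 4) (n := 3) (by norm_num),
    ← Int.pow_dvd_pow_iff (a := (k : ℤ) ^ 6) (n := 2) (by norm_num), ← pow_mul, ← pow_mul]
  push_cast
  rfl

lemma Δ_shortCurve (A B : ℚ) : (shortCurve A B).Δ = -16 * (4 * A ^ 3 + 27 * B ^ 2) := by
  simp only [shortCurve, WeierstrassCurve.Δ, WeierstrassCurve.b₂, WeierstrassCurve.b₄,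
    WeierstrassCurve.b₆, WeierstrassCurve.b₈]
  ring

/-- Isomorphism classes correspond to reduced pairs of coefficients of nonzero discriminant. -/
lemma ncard_image_mk (P : ℤ × ℤ → Prop) (S : Set EllipticCurveQ)
    (hS : ∀ E, E ∈ S ↔ P (minimalCoeffs E)) :
    (Quotient.mk isoSetoid '' S).ncard =
      {p : ℤ × ℤ | IsReducedPair p ∧ 4 * p.1 ^ 3 + 27 * p.2 ^ 2 ≠ 0 ∧ P p}.ncard := by
  have hiso (E E' : EllipticCurveQ) (h : IsIsomorphic E.1 E'.1) :
      minimalCoeffs E = minimalCoeffs E' :=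
    minimalCoeffs_eq ⟨h.trans (isMinimalEquation_minimalCoeffs E').1,
      (isMinimalEquation_minimalCoeffs E').2⟩
  let f : Quotient isoSetoid → ℤ × ℤ := Quotient.lift minimalCoeffs hiso
  have hf : Function.Injective f := by
    rintro ⟨E⟩ ⟨E'⟩ h
    have h1 := (isMinimalEquation_minimalCoeffs E).1
    have h2 := (isMinimalEquation_minimalCoeffs E').1
    have h3 : minimalCoeffs E = minimalCoeffs E' := h
    rw [h3] at h1
    exact Quotient.sound (h1.trans h2.symm)
  rw [← Set.ncard_image_of_injective _ hf, Set.image_image]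
  congr 1
  ext p
  constructor
  · rintro ⟨E, hE, rfl⟩
    have hm := isMinimalEquation_minimalCoeffs E
    refine ⟨hm.2, fun h0 => ?_, (hS E).1 hE⟩
    obtain ⟨C, hC⟩ := hm.1
    have hell : (C • E.1).IsElliptic := inferInstance
    rw [hC] at hell
    apply hell.isUnit.ne_zero
    rw [Δ_shortCurve]
    have : (4 * ((minimalCoeffs E).1 : ℚ) ^ 3 + 27 * ((minimalCoeffs E).2 : ℚ) ^ 2) = 0 := by
      exact_mod_cast h0
    rw [this, mul_zero]
  · rintro ⟨hred, hΔ, hp⟩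
    have hell : (shortCurve (p.1 : ℚ) (p.2 : ℚ)).IsElliptic := by
      refine ⟨IsUnit.mk0 _ ?_⟩
      rw [Δ_shortCurve]
      exact mul_ne_zero (by norm_num) (by exact_mod_cast hΔ)
    have hmin : minimalCoeffs ⟨_, hell⟩ = p := minimalCoeffs_eq ⟨.refl _, hred⟩
    exact ⟨⟨_, hell⟩, (hS _).2 (by rwa [hmin]), hmin⟩

/-- A rational root of `3x⁴ + 6Ax² + 12Bx - A²` with integers `A` and `B` is an integer: `3x` is a
root of a monic integral polynomial, and is divisible by three. -/
lemma exists_int_root {A B : ℤ}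
    (h : ∃ x : ℚ, 3 * x ^ 4 + 6 * A * x ^ 2 + 12 * B * x = (A : ℚ) ^ 2) :
    ∃ r : ℤ, 3 * r ^ 4 + 6 * A * r ^ 2 + 12 * B * r = A ^ 2 := by
  obtain ⟨x, hx⟩ := h
  obtain ⟨z, hz⟩ : ∃ z : ℚ, z = 3 * x := ⟨_, rfl⟩
  have hzd : z * z.den = z.num := Rat.mul_den_eq_num z
  have h1 : z ^ 4 = -18 * A * z ^ 2 - 108 * B * z + 27 * A ^ 2 := by
    rw [hz]
    linear_combination 27 * hx
  have h2 : z.num ^ 4 = (z.den : ℤ) *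
      (-18 * A * z.num ^ 2 * z.den - 108 * B * z.num * z.den ^ 2 + 27 * A ^ 2 * z.den ^ 3) := by
    have : (z.num : ℚ) ^ 4 = (z.den : ℚ) * (-18 * A * (z.num : ℚ) ^ 2 * z.den -
        108 * B * z.num * (z.den : ℚ) ^ 2 + 27 * A ^ 2 * (z.den : ℚ) ^ 3) := by
      rw [← hzd]
      linear_combination (z.den : ℚ) ^ 4 * h1
    exact_mod_cast this
  have hcop : IsCoprime (z.den : ℤ) (z.num ^ 4) := (Rat.isCoprime_num_den z).symm.pow_right
  have hden : z.den = 1 := by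
    have := hcop.isUnit_of_dvd' dvd_rfl ⟨_, h2⟩
    exact_mod_cast Int.isUnit_iff_natAbs_eq.1 this
  rw [hden] at h2
  have h3 : (3 : ℤ) ∣ z.num := by
    refine Int.prime_three.dvd_of_dvd_pow (n := 4)
      ⟨-6 * A * z.num ^ 2 - 36 * B * z.num + 9 * A ^ 2, ?_⟩
    rw [h2]
    push_cast
    ring
  obtain ⟨r, hr⟩ := h3
  refine ⟨r, ?_⟩
  rw [hr] at h2
  push_cast at h2
  linarith

/-- The coefficients `(A, B)`, reduced or not, with `A ≠ 0`, `|A| < Y²` and `|B| < Y³`, of the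
elliptic curves with a rational three-isogeny. -/
def isogenyPairs (Y : ℝ) : Set (ℤ × ℤ) :=
  {p | p.1 ≠ 0 ∧ 4 * p.1 ^ 3 + 27 * p.2 ^ 2 ≠ 0 ∧ |(p.1 : ℝ)| < Y ^ 2 ∧ |(p.2 : ℝ)| < Y ^ 3 ∧
    ∃ r : ℤ, 3 * r ^ 4 + 6 * p.1 * r ^ 2 + 12 * p.2 * r = p.1 ^ 2}

/-- The reduced pairs among `isogenyPairs Y`. -/
def reducedIsogenyPairs (Y : ℝ) : Set (ℤ × ℤ) := {p | p ∈ isogenyPairs Y ∧ IsReducedPair p}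

lemma naiveHeight_lt_iff (E : EllipticCurveQ) {Y : ℝ} (hY : 0 ≤ Y) :
    (naiveHeight E : ℝ) < Y ^ 6 ↔
      |((minimalCoeffs E).1 : ℝ)| < Y ^ 2 ∧ |((minimalCoeffs E).2 : ℝ)| < Y ^ 3 := by
  rw [naiveHeight]
  push_cast
  rw [max_lt_iff, show Y ^ 6 = (Y ^ 2) ^ 3 by ring,
    pow_lt_pow_iff_left₀ (abs_nonneg _) (by positivity) three_ne_zero,
    show (Y ^ 2) ^ 3 = (Y ^ 3) ^ 2 by ring,
    pow_lt_pow_iff_left₀ (abs_nonneg _) (by positivity) two_ne_zero]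

lemma exists_root_iff {A B : ℤ} :
    (∃ x : ℚ, 3 * x ^ 4 + 6 * A * x ^ 2 + 12 * B * x = (A : ℚ) ^ 2) ↔
      ∃ r : ℤ, 3 * r ^ 4 + 6 * A * r ^ 2 + 12 * B * r = A ^ 2 :=
  ⟨exists_int_root, fun ⟨r, hr⟩ => ⟨r, by exact_mod_cast hr⟩⟩

lemma countJNeZero_three {Y : ℝ} (hY : 0 ≤ Y) :
    countJNeZero 3 (Y ^ 6) = (reducedIsogenyPairs Y).ncard := by
  rw [countJNeZero, ncard_image_mk fun p => (|(p.1 : ℝ)| < Y ^ 2 ∧ |(p.2 : ℝ)| < Y ^ 3) ∧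
    (∃ r : ℤ, 3 * r ^ 4 + 6 * p.1 * r ^ 2 + 12 * p.2 * r = p.1 ^ 2) ∧ p.1 ≠ 0]
  · congr 1
    ext p
    simp only [reducedIsogenyPairs, isogenyPairs, Set.mem_ofPred_eq]
    tauto
  · intro E
    have h := (isMinimalEquation_minimalCoeffs E).1
    rw [Set.mem_ofPred_eq, naiveHeight_lt_iff E hY, hasRationalIsogeny_three_iff_of_isIsomorphic h,
      Ne, j_eq_zero_iff_of_isIsomorphic h, Int.cast_eq_zero, exists_root_iff]

lemma countJEqZero_three {Y : ℝ} (hY : 0 ≤ Y) :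
    countJEqZero 3 (Y ^ 6) =
      {B : ℤ | B ≠ 0 ∧ |(B : ℝ)| < Y ^ 3 ∧ IsReducedPair (0, B)}.ncard := by
  rw [countJEqZero, ncard_image_mk fun p => (|(p.1 : ℝ)| < Y ^ 2 ∧ |(p.2 : ℝ)| < Y ^ 3) ∧ p.1 = 0]
  · refine Eq.trans ?_ (Set.ncard_image_of_injective _ (Prod.mk_right_injective (0 : ℤ)))
    congr 1
    ext ⟨A, B⟩
    simp only [Set.mem_ofPred_eq, Set.mem_image, Prod.mk.injEq]
    constructor
    · rintro ⟨hred, hΔ, ⟨-, hB⟩, rfl⟩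
      exact ⟨B, ⟨by rintro rfl; simp at hΔ, hB, hred⟩, rfl, rfl⟩
    · rintro ⟨B, ⟨hB0, hB, hred⟩, rfl, rfl⟩
      have hY0 : 0 < Y := by
        by_contra! h0
        have h1 : Y = 0 := le_antisymm h0 hY
        rw [h1] at hB
        norm_num at hB
        linarith [abs_nonneg (B : ℝ)]
      exact ⟨hred, by simpa using hB0, ⟨by rw [Int.cast_zero, abs_zero]; positivity, hB⟩, rfl⟩
  · intro E
    have h := (isMinimalEquation_minimalCoeffs E).1
    rw [Set.mem_ofPred_eq, naiveHeight_lt_iff E hY, hasRationalIsogeny_three_iff_of_isIsomorphic h,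
      j_eq_zero_iff_of_isIsomorphic h, Int.cast_eq_zero]
    -- For `A = 0` the point with `x = 0` always has order three.
    refine and_congr_right fun _ => ⟨fun hA => hA.2, fun hA => ⟨⟨0, ?_⟩, hA⟩⟩
    simp [hA]

/-! ### Squarefree numbers and the count for `j = 0` -/

lemma sum_inv_sq_le {n : ℕ} (hn : 2 ≤ n) :
    ∑ k ∈ Finset.Icc 2 n, ((k : ℝ) ^ 2)⁻¹ ≤ 3 / 4 - (n : ℝ)⁻¹ := by
  rw [Finset.Icc_eq_cons_Ioc hn, Finset.sum_cons]
  have := sum_Ioc_inv_sq_le_sub (α := ℝ) two_ne_zero hn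
  norm_num at this ⊢
  linarith

/-- At least a quarter of the numbers up to `N` are squarefree, as `∑ 1 / k² < 3 / 4` over
`k ≥ 2`. -/
lemma le_four_mul_card_squarefree (N : ℕ) :
    N ≤ 4 * ((Finset.Ioc 0 N).filter Squarefree).card := by
  rcases Nat.lt_or_ge N 2 with hN | hN
  · interval_cases N
    · simp
    · have : (1 : ℕ) ∈ (Finset.Ioc 0 1).filter Squarefree := by simp
      have := Finset.card_pos.2 ⟨_, this⟩
      omega
  have hsub : (Finset.Ioc 0 N).filter (fun s => ¬ Squarefree s) ⊆
      (Finset.Icc 2 N).biUnion fun k => (Finset.Ioc 0 N).filter (k ^ 2 ∣ ·) := by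
    intro s hs
    simp only [Finset.mem_filter, Finset.mem_Ioc, Finset.mem_biUnion, Finset.mem_Icc] at hs ⊢
    obtain ⟨⟨hs0, hsN⟩, hsq⟩ := hs
    rw [Squarefree] at hsq
    push Not at hsq
    obtain ⟨k, hk, hk1⟩ := hsq
    rw [Nat.isUnit_iff] at hk1
    have hks := Nat.le_of_dvd hs0 hk
    have hk0 : k ≠ 0 := by
      rintro rfl
      simp at hk
      omega
    exact ⟨k, ⟨by omega, by nlinarith [Nat.pos_of_ne_zero hk0]⟩, ⟨hs0, hsN⟩, by rwa [sq]⟩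
  have hbad : (((Finset.Ioc 0 N).filter (fun s => ¬ Squarefree s)).card : ℝ) ≤ N * (3 / 4) := by
    calc (((Finset.Ioc 0 N).filter (fun s => ¬ Squarefree s)).card : ℝ)
        ≤ ∑ k ∈ Finset.Icc 2 N, (N : ℝ) * ((k : ℝ) ^ 2)⁻¹ := by
          have h1 := (Finset.card_le_card hsub).trans Finset.card_biUnion_le
          have h2 : (((Finset.Ioc 0 N).filter (fun s => ¬ Squarefree s)).card : ℝ) ≤
              ∑ k ∈ Finset.Icc 2 N, (((Finset.Ioc 0 N).filter (k ^ 2 ∣ ·)).card : ℝ) := by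
            exact_mod_cast h1
          refine h2.trans (Finset.sum_le_sum fun k _ => ?_)
          rw [Nat.Ioc_filter_dvd_card_eq_div, ← div_eq_mul_inv]
          exact_mod_cast Nat.cast_div_le (α := ℝ) (m := N) (n := k ^ 2)
      _ = N * ∑ k ∈ Finset.Icc 2 N, ((k : ℝ) ^ 2)⁻¹ := by rw [Finset.mul_sum]
      _ ≤ N * (3 / 4) := by
          gcongr
          have : (0 : ℝ) ≤ (N : ℝ)⁻¹ := by positivity
          linarith [sum_inv_sq_le hN]
  have htot := Finset.card_filter_add_card_filter_not (s := Finset.Ioc 0 N) Squarefree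
  rw [Nat.card_Ioc, Nat.sub_zero] at htot
  have htot' : (((Finset.Ioc 0 N).filter Squarefree).card : ℝ) +
      ((Finset.Ioc 0 N).filter (fun s => ¬ Squarefree s)).card = N := by exact_mod_cast htot
  have : (N : ℝ) ≤ 4 * ((Finset.Ioc 0 N).filter Squarefree).card := by linarith
  exact_mod_cast this

/-- For `X ≥ 0` the bounds are stated in terms of `Y = X ^ (1 / 6)`, the scale at which a curve of
height less than `X` has `|A| < Y²` and `|B| < Y³`. -/
lemma isTheta_of_bounds {f g : ℝ → ℝ} {c₁ c₂ Y₀ : ℝ} (hc₁ : 0 < c₁)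
    (h : ∀ Y ≥ Y₀, 0 ≤ g (Y ^ 6) ∧ c₁ * g (Y ^ 6) ≤ f (Y ^ 6) ∧ f (Y ^ 6) ≤ c₂ * g (Y ^ 6)) :
    f =Θ[Filter.atTop] g := by
  have hev : ∀ᶠ X : ℝ in Filter.atTop, 0 ≤ g X ∧ c₁ * g X ≤ f X ∧ f X ≤ c₂ * g X := by
    filter_upwards [(tendsto_rpow_atTop (y := 1 / 6) (by norm_num)).eventually_ge_atTop Y₀,
      Filter.eventually_ge_atTop 0] with X hX hX0
    have hX6 : (X ^ (1 / 6 : ℝ)) ^ 6 = X := by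
      rw [← Real.rpow_natCast, ← Real.rpow_mul hX0]
      norm_num
    simpa only [hX6] using h _ hX
  constructor
  · refine Asymptotics.IsBigO.of_bound c₂ ?_
    filter_upwards [hev] with X ⟨h0, h1, h2⟩
    rwa [Real.norm_of_nonneg h0, Real.norm_of_nonneg ((mul_nonneg hc₁.le h0).trans h1)]
  · refine Asymptotics.IsBigO.of_bound c₁⁻¹ ?_
    filter_upwards [hev] with X ⟨h0, h1, h2⟩
    rw [Real.norm_of_nonneg h0, Real.norm_of_nonneg ((mul_nonneg hc₁.le h0).trans h1)]
    rwa [inv_mul_eq_div, le_div_iff₀' hc₁]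

lemma isReducedPair_zero_of_squarefree {s : ℕ} (hs : Squarefree s) :
    IsReducedPair (0, (s : ℤ)) := by
  rw [isReducedPair_iff]
  rintro k hk ⟨-, h⟩
  have h6 : k ^ 6 ∣ s := by
    have h' : (k : ℤ) ^ 6 ∣ (s : ℤ) := h
    exact_mod_cast h'
  have h2 : k * k ∣ s := (Dvd.intro (k ^ 4) (by ring)).trans h6
  have := Nat.isUnit_iff.1 (hs k h2)
  omega

theorem countJEqZero_three_isTheta :
    (fun X : ℝ => (countJEqZero 3 X : ℝ)) =Θ[Filter.atTop] (fun X : ℝ => X ^ (1 / 2 : ℝ)) := by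
  refine isTheta_of_bounds (c₁ := 1 / 16) (c₂ := 3) (Y₀ := 2) (by norm_num) fun Y hY => ?_
  have hY0 : 0 ≤ Y := by linarith
  have hg : (Y ^ 6) ^ (1 / 2 : ℝ) = Y ^ 3 := by
    rw [← Real.rpow_natCast, ← Real.rpow_natCast, ← Real.rpow_mul hY0]
    norm_num
  rw [hg, countJEqZero_three hY0]
  have hZ : (8 : ℝ) ≤ Y ^ 3 := by
    calc (8 : ℝ) = 2 ^ 3 := by norm_num
      _ ≤ Y ^ 3 := by gcongr
  generalize Y ^ 3 = Z at *
  have hsub : {B : ℤ | B ≠ 0 ∧ |(B : ℝ)| < Z ∧ IsReducedPair (0, B)} ⊆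
      (Finset.Icc (-⌊Z⌋) ⌊Z⌋ : Finset ℤ) := by
    rintro B ⟨-, hB, -⟩
    rw [abs_lt] at hB
    simp only [Finset.coe_Icc, Set.mem_Icc]
    exact ⟨neg_le.1 (Int.le_floor.2 (by push_cast; linarith)), Int.le_floor.2 hB.2.le⟩
  refine ⟨by linarith, ?_, ?_⟩
  · have hN : ((⌊Z / 2⌋₊ : ℕ) : ℝ) ≤ Z / 2 := Nat.floor_le (by linarith)
    have hN' : Z / 2 - 1 < (⌊Z / 2⌋₊ : ℕ) := Nat.sub_one_lt_floor _
    have h1 := le_four_mul_card_squarefree ⌊Z / 2⌋₊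
    have h2 : ((Finset.Ioc 0 ⌊Z / 2⌋₊).filter Squarefree).card ≤
        {B : ℤ | B ≠ 0 ∧ |(B : ℝ)| < Z ∧ IsReducedPair (0, B)}.ncard := by
      rw [← Set.ncard_coe_finset]
      refine Set.ncard_le_ncard_of_injOn (fun s : ℕ => (s : ℤ)) ?_ Nat.cast_injective.injOn
        ((Finset.finite_toSet _).subset hsub)
      intro s hs
      simp only [Finset.coe_filter, Finset.mem_Ioc, Set.mem_ofPred_eq] at hs
      refine ⟨by exact_mod_cast hs.1.1.ne', ?_, isReducedPair_zero_of_squarefree hs.2⟩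
      have : (s : ℝ) ≤ (⌊Z / 2⌋₊ : ℕ) := by exact_mod_cast hs.1.2
      rw [Int.cast_natCast, Nat.abs_cast]
      linarith
    have h3 : ((⌊Z / 2⌋₊ : ℕ) : ℝ) ≤
        4 * {B : ℤ | B ≠ 0 ∧ |(B : ℝ)| < Z ∧ IsReducedPair (0, B)}.ncard := by
      exact_mod_cast h1.trans (Nat.mul_le_mul_left 4 h2)
    linarith
  · have h1 := Set.ncard_le_ncard hsub (Finset.finite_toSet _)
    rw [Set.ncard_coe_finset, Int.card_Icc] at h1
    have hfl : 0 ≤ ⌊Z⌋ := Int.floor_nonneg.2 (by linarith)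
    have h2 : ({B : ℤ | B ≠ 0 ∧ |(B : ℝ)| < Z ∧ IsReducedPair (0, B)}.ncard : ℤ) ≤
        2 * ⌊Z⌋ + 1 := by omega
    have h3 : ({B : ℤ | B ≠ 0 ∧ |(B : ℝ)| < Z ∧ IsReducedPair (0, B)}.ncard : ℝ) ≤
        2 * (⌊Z⌋ : ℝ) + 1 := by exact_mod_cast h2
    linarith [Int.floor_le Z]

/-! ### The upper bound for `j ≠ 0` -/

lemma abs_root_le {A B r Y : ℝ} (hA : |A| < Y ^ 2) (hB : |B| < Y ^ 3) (hY : 0 < Y)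
    (h : 3 * r ^ 4 + 6 * A * r ^ 2 + 12 * B * r = A ^ 2) : |r| ≤ 3 * Y := by
  by_contra! hr
  have h1 : 3 * |r| ^ 4 ≤ |A| ^ 2 + 6 * |A| * |r| ^ 2 + 12 * |B| * |r| := by
    have e : 3 * |r| ^ 4 = |A ^ 2 - 6 * A * r ^ 2 - 12 * B * r| := by
      rw [show A ^ 2 - 6 * A * r ^ 2 - 12 * B * r = 3 * r ^ 4 by linarith, abs_mul, abs_pow,
        abs_of_pos (show (0 : ℝ) < 3 by norm_num)]
    rw [e]
    refine (abs_sub _ _).trans (add_le_add ((abs_sub _ _).trans (add_le_add ?_ ?_)) ?_) <;>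
      simp [abs_mul]
  generalize |r| = ρ at *
  have hρ : 0 < ρ := by linarith
  have hA' : |A| ≤ ρ ^ 2 / 9 := by nlinarith
  have hB' : |B| ≤ ρ ^ 3 / 27 := by
    have : (3 * Y) ^ 3 ≤ ρ ^ 3 := by gcongr
    linarith [show (3 * Y) ^ 3 = 27 * Y ^ 3 by ring]
  have h2 : 3 * ρ ^ 4 ≤ (ρ ^ 2 / 9) ^ 2 + 6 * (ρ ^ 2 / 9) * ρ ^ 2 + 12 * (ρ ^ 3 / 27) * ρ := by
    refine h1.trans ?_
    gcongr
  have h4 : 0 < ρ ^ 4 := by positivity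
  linarith [show (ρ ^ 2 / 9) ^ 2 + 6 * (ρ ^ 2 / 9) * ρ ^ 2 + 12 * (ρ ^ 3 / 27) * ρ =
    (1 / 81 + 6 / 9 + 12 / 27) * ρ ^ 4 by ring]

lemma sq_le_of_root {A B r Y : ℝ} (hA : |A| < Y ^ 2) (hB : |B| < Y ^ 3) (hY : 0 < Y)
    (h : 3 * r ^ 4 + 6 * A * r ^ 2 + 12 * B * r = A ^ 2) : A ^ 2 ≤ 111 * |r| * Y ^ 3 := by
  have hr := abs_root_le hA hB hY h
  calc A ^ 2 = |r * (3 * r ^ 3 + 6 * A * r + 12 * B)| := by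
        rw [← abs_of_nonneg (sq_nonneg A), ← h]
        ring_nf
    _ ≤ |r| * (3 * |r| ^ 3 + 6 * |A| * |r| + 12 * |B|) := by
        rw [abs_mul]
        gcongr
        refine (abs_add_le _ _).trans (add_le_add ((abs_add_le _ _).trans (add_le_add ?_ ?_)) ?_) <;>
          simp [abs_mul]
    _ ≤ |r| * (3 * (3 * Y) ^ 3 + 6 * Y ^ 2 * (3 * Y) + 12 * Y ^ 3) := by gcongr
    _ = 111 * |r| * Y ^ 3 := by ring

/-- If `r` divides `A²`, write `|r| = s m²` with `s` squarefree; then `s m` divides `A`. -/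
lemma exists_eq_mul_of_dvd_sq {A r : ℤ} (hr : r ≠ 0) (h : r ∣ A ^ 2) :
    ∃ (ε : ℤ) (s m : ℕ) (n : ℤ), (ε = 1 ∨ ε = -1) ∧ 0 < s ∧ 0 < m ∧
      r = ε * (s * m ^ 2) ∧ A = s * m * n := by
  obtain ⟨s, m, hs0, hm0, hsm, hs⟩ := Nat.sq_mul_squarefree_of_pos (Int.natAbs_pos.2 hr)
  have hd : m ^ 2 * s ∣ A.natAbs ^ 2 := by
    rw [hsm, ← Int.natAbs_pow]
    exact Int.natAbs_dvd_natAbs.2 h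
  obtain ⟨a, ha⟩ := (Nat.pow_dvd_pow_iff two_ne_zero).1 ((Dvd.intro _ rfl).trans hd)
  rw [ha, mul_pow] at hd
  have hsa : s ∣ a := (hs.dvd_pow_iff_dvd two_ne_zero).1
    (Nat.dvd_of_mul_dvd_mul_left (by positivity) hd)
  obtain ⟨n, hn⟩ : (s * m : ℤ) ∣ A := by
    rw [← Int.natCast_mul, Int.natCast_dvd, ha, mul_comm]
    exact Nat.mul_dvd_mul_left m hsa
  have hrε : r = r.sign * (s * m ^ 2) := by
    conv_lhs => rw [← Int.sign_mul_natAbs r, ← hsm]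
    push_cast
    ring
  refine ⟨r.sign, s, m, n, ?_, hs0, hm0, hrε, hn⟩
  rcases lt_or_gt_of_ne hr with h | h
  · exact .inr (Int.sign_eq_neg_one_of_neg h)
  · exact .inl (Int.sign_eq_one_of_pos h)

lemma sum_inv_sqrt_le (n : ℕ) : ∑ s ∈ Finset.Ioc 0 n, (√(s : ℝ))⁻¹ ≤ 2 * √(n : ℝ) := by
  induction n with
  | zero => simp
  | succ n ih =>
    rw [Finset.sum_Ioc_succ_top (by omega)]
    have h1 : 0 < √((n + 1 : ℕ) : ℝ) := Real.sqrt_pos.2 (by positivity)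
    have h2 : √((n + 1 : ℕ) : ℝ) ^ 2 = n + 1 := by
      rw [Real.sq_sqrt (by positivity)]; push_cast; rfl
    have h3 : √(n : ℝ) ^ 2 = n := Real.sq_sqrt (by positivity)
    have h4 : (√((n + 1 : ℕ) : ℝ))⁻¹ ≤ 2 * √((n + 1 : ℕ) : ℝ) - 2 * √(n : ℝ) := by
      rw [inv_le_iff_one_le_mul₀ h1]
      nlinarith [sq_nonneg (√((n + 1 : ℕ) : ℝ) - √(n : ℝ))]
    linarith

/-- The pairs with a root `r = ε s m²` and `A = s m n`; the coefficient `B` is determined by `A`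
and `r`. -/
noncomputable def pairsOfRoot (L : ℝ) (m s : ℕ) : Finset (ℤ × ℤ) :=
  (({1, -1} : Finset ℤ) ×ˢ Finset.Icc (-⌊L⌋) ⌊L⌋).image fun q =>
    (s * m * q.2, ((s * m * q.2) ^ 2 - 3 * (q.1 * (s * m ^ 2)) ^ 4 -
      6 * (s * m * q.2) * (q.1 * (s * m ^ 2)) ^ 2) / (12 * (q.1 * (s * m ^ 2))))

lemma card_pairsOfRoot_le {L : ℝ} (hL : 1 ≤ L) (m s : ℕ) :
    ((pairsOfRoot L m s).card : ℝ) ≤ 6 * L := by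
  have h1 : (pairsOfRoot L m s).card ≤ 2 * (2 * ⌊L⌋ + 1).toNat := by
    refine Finset.card_image_le.trans ?_
    rw [Finset.card_product, Int.card_Icc]
    refine Nat.mul_le_mul (Finset.card_le_two) (le_of_eq ?_)
    congr 1
    ring
  have hfl : 0 ≤ ⌊L⌋ := Int.floor_nonneg.2 (by linarith)
  have h2 : ((pairsOfRoot L m s).card : ℤ) ≤ 2 * (2 * ⌊L⌋ + 1) := by omega
  have h3 : ((pairsOfRoot L m s).card : ℝ) ≤ 2 * (2 * (⌊L⌋ : ℝ) + 1) := by exact_mod_cast h2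
  linarith [Int.floor_le L]

lemma isogenyPairs_subset {Y : ℝ} (hY : 0 < Y) :
    isogenyPairs Y ⊆ ((Finset.Ioc 0 ⌊3 * Y⌋₊).biUnion fun m =>
      (Finset.Ioc 0 (⌊3 * Y⌋₊ / m ^ 2)).biUnion fun s =>
        pairsOfRoot (√(111 * Y ^ 3) / √s) m s : Finset (ℤ × ℤ)) := by
  rintro ⟨A, B⟩ ⟨hA0, -, hA, hB, r, hr⟩
  dsimp only at hA0 hA hB hr
  have hr0 : r ≠ 0 := by
    rintro rfl
    apply hA0
    simpa using hr.symm
  have hrR : 3 * (r : ℝ) ^ 4 + 6 * (A : ℝ) * (r : ℝ) ^ 2 + 12 * (B : ℝ) * r = (A : ℝ) ^ 2 := by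
    exact_mod_cast hr
  obtain ⟨ε, s, m, n, hε, hs, hm, hrsm, hAsm⟩ := exists_eq_mul_of_dvd_sq (A := A) hr0
    ⟨3 * r ^ 3 + 6 * A * r + 12 * B, by rw [← hr]; ring⟩
  have habs : |(r : ℝ)| = s * m ^ 2 := by
    rw [hrsm]
    push_cast
    rw [abs_mul, abs_of_nonneg (a := (s * m ^ 2 : ℝ)) (by positivity)]
    rcases hε with rfl | rfl <;> simp
  have h1 := abs_root_le hA hB hY hrR
  have h2 := sq_le_of_root hA hB hY hrR
  rw [habs] at h1 h2
  have hsm : s * m ^ 2 ≤ ⌊3 * Y⌋₊ := Nat.le_floor (by push_cast; exact h1)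
  have hsn : (s : ℝ) * (n : ℝ) ^ 2 ≤ 111 * Y ^ 3 := by
    have h3 : (0 : ℝ) < s * m ^ 2 := by positivity
    refine le_of_mul_le_mul_left ?_ h3
    rw [hAsm] at h2
    push_cast at h2
    linarith [show (s * m * n : ℝ) ^ 2 = s * m ^ 2 * (s * n ^ 2) by ring]
  have hnL : |(n : ℝ)| ≤ √(111 * Y ^ 3) / √s := by
    rw [le_div_iff₀ (Real.sqrt_pos.2 (by positivity)), ← Real.sqrt_sq_eq_abs,
      ← Real.sqrt_mul (sq_nonneg _), mul_comm]
    exact Real.sqrt_le_sqrt hsn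
  rw [abs_le] at hnL
  simp only [Finset.coe_biUnion, Set.mem_iUnion, Finset.mem_coe, Finset.mem_Ioc, exists_prop,
    pairsOfRoot, Finset.mem_image, Finset.mem_product, Finset.mem_insert, Finset.mem_singleton,
    Finset.mem_Icc]
  refine ⟨m, ⟨hm, ?_⟩, s, ⟨hs, (Nat.le_div_iff_mul_le (by positivity)).2 hsm⟩, (ε, n),
    ⟨hε, neg_le.1 (Int.le_floor.2 (by push_cast; linarith)), Int.le_floor.2 hnL.2⟩, ?_⟩
  · nlinarith
  · rw [← hAsm, ← hrsm, Prod.mk.injEq]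
    refine ⟨rfl, Int.ediv_eq_of_eq_mul_right (mul_ne_zero (by norm_num) hr0) ?_⟩
    rw [← hr]
    ring

lemma finite_isogenyPairs {Y : ℝ} (hY : 0 < Y) : (isogenyPairs Y).Finite :=
  (Finset.finite_toSet _).subset (isogenyPairs_subset hY)

/-- The number of quadruples `(ε, s, m, n)` is at most of order
`∑ₘ ∑ₛ (Y³ / s)^(1/2)` over `s m² ≤ 3Y`, which is of order `∑ₘ Y² / m`. -/
lemma ncard_isogenyPairs_le {Y : ℝ} (hY : 1 ≤ Y) :
    ((isogenyPairs Y).ncard : ℝ) ≤ 720 * (Y ^ 2 * (1 + Real.log Y)) := by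
  have hY0 : 0 < Y := by linarith
  have hfl : (⌊3 * Y⌋₊ : ℝ) ≤ 3 * Y := Nat.floor_le (by linarith)
  have h333 : √(111 * Y ^ 3) * √(3 * Y) ≤ 20 * Y ^ 2 := by
    rw [← Real.sqrt_mul (by positivity)]
    refine Real.sqrt_le_iff.2 ⟨by positivity, ?_⟩
    nlinarith [show 0 < Y ^ 4 by positivity]
  have hinner (m : ℕ) (hm : m ∈ Finset.Ioc 0 ⌊3 * Y⌋₊) :
      ((((Finset.Ioc 0 (⌊3 * Y⌋₊ / m ^ 2)).biUnion fun s =>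
        pairsOfRoot (√(111 * Y ^ 3) / √s) m s).card : ℕ) : ℝ) ≤ 240 * Y ^ 2 * (m : ℝ)⁻¹ := by
    have hm0 : (0 : ℝ) < m := by exact_mod_cast (Finset.mem_Ioc.1 hm).1
    have hq : ((⌊3 * Y⌋₊ / m ^ 2 : ℕ) : ℝ) ≤ 3 * Y / m ^ 2 := by
      refine Nat.cast_div_le.trans ?_
      push_cast
      gcongr
    calc ((((Finset.Ioc 0 (⌊3 * Y⌋₊ / m ^ 2)).biUnion fun s =>
          pairsOfRoot (√(111 * Y ^ 3) / √s) m s).card : ℕ) : ℝ)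
        ≤ ∑ s ∈ Finset.Ioc 0 (⌊3 * Y⌋₊ / m ^ 2),
            ((pairsOfRoot (√(111 * Y ^ 3) / √s) m s).card : ℝ) := by
          exact_mod_cast Finset.card_biUnion_le
      _ ≤ ∑ s ∈ Finset.Ioc 0 (⌊3 * Y⌋₊ / m ^ 2), 6 * √(111 * Y ^ 3) * (√(s : ℝ))⁻¹ := by
          refine Finset.sum_le_sum fun s hs => ?_
          rw [mul_assoc, ← div_eq_mul_inv]
          refine card_pairsOfRoot_le ?_ m s
          rw [Finset.mem_Ioc] at hs
          have hs0 : (0 : ℝ) < s := by exact_mod_cast hs.1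
          rw [one_le_div (Real.sqrt_pos.2 hs0)]
          refine Real.sqrt_le_sqrt ?_
          have h1 : s ≤ ⌊3 * Y⌋₊ := hs.2.trans (Nat.div_le_self _ _)
          have h2 : (s : ℝ) ≤ ⌊3 * Y⌋₊ := by exact_mod_cast h1
          nlinarith [mul_le_mul hY hY zero_le_one hY0.le]
      _ = 6 * √(111 * Y ^ 3) * ∑ s ∈ Finset.Ioc 0 (⌊3 * Y⌋₊ / m ^ 2), (√(s : ℝ))⁻¹ := by
          rw [Finset.mul_sum]
      _ ≤ 6 * √(111 * Y ^ 3) * (2 * (√(3 * Y) / m)) := by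
          gcongr
          refine (sum_inv_sqrt_le _).trans ?_
          gcongr
          refine (Real.sqrt_le_sqrt hq).trans_eq ?_
          rw [Real.sqrt_div (by positivity), Real.sqrt_sq hm0.le]
      _ = 12 * (√(111 * Y ^ 3) * √(3 * Y)) * (m : ℝ)⁻¹ := by ring
      _ ≤ 12 * (20 * Y ^ 2) * (m : ℝ)⁻¹ := by gcongr
      _ = 240 * Y ^ 2 * (m : ℝ)⁻¹ := by ring
  have hharm : ∑ m ∈ Finset.Ioc 0 ⌊3 * Y⌋₊, (m : ℝ)⁻¹ ≤ 3 * (1 + Real.log Y) := by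
    have h1 := harmonic_floor_le_one_add_log (3 * Y) (by linarith)
    rw [harmonic_eq_sum_Icc, show Finset.Icc 1 ⌊3 * Y⌋₊ = Finset.Ioc 0 ⌊3 * Y⌋₊ from rfl] at h1
    push_cast at h1
    rw [Real.log_mul (by norm_num) hY0.ne'] at h1
    have h3 := Real.log_le_sub_one_of_pos (show (0 : ℝ) < 3 by norm_num)
    linarith [Real.log_nonneg hY]
  have hcard := Set.ncard_le_ncard (isogenyPairs_subset hY0) (Finset.finite_toSet _)
  rw [Set.ncard_coe_finset] at hcard
  calc ((isogenyPairs Y).ncard : ℝ)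
      ≤ ∑ m ∈ Finset.Ioc 0 ⌊3 * Y⌋₊, ((((Finset.Ioc 0 (⌊3 * Y⌋₊ / m ^ 2)).biUnion fun s =>
          pairsOfRoot (√(111 * Y ^ 3) / √s) m s).card : ℕ) : ℝ) := by
        exact_mod_cast hcard.trans Finset.card_biUnion_le
    _ ≤ ∑ m ∈ Finset.Ioc 0 ⌊3 * Y⌋₊, 240 * Y ^ 2 * (m : ℝ)⁻¹ := Finset.sum_le_sum hinner
    _ = 240 * Y ^ 2 * ∑ m ∈ Finset.Ioc 0 ⌊3 * Y⌋₊, (m : ℝ)⁻¹ := by rw [Finset.mul_sum]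
    _ ≤ 240 * Y ^ 2 * (3 * (1 + Real.log Y)) := by gcongr
    _ = 720 * (Y ^ 2 * (1 + Real.log Y)) := by ring

/-! ### The lower bound for `j ≠ 0` -/

lemma eq_of_squarefree_mul_sq {s t m n : ℕ} (hs : Squarefree s) (ht : Squarefree t) (hm : 0 < m)
    (h : s * m ^ 2 = t * n ^ 2) : s = t ∧ m = n := by
  have hn : 0 < n := by
    rcases Nat.eq_zero_or_pos n with rfl | hn
    · have := hs.ne_zero
      simp_all
    · exact hn
  -- After removing common factors, the square of `m` divides the squarefree number `t`.
  have key : ∀ {s t m n : ℕ}, Squarefree t → m.Coprime n → s * m ^ 2 = t * n ^ 2 → m = 1 := by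
    intro s t m n ht hmn h
    have h1 : m * m ∣ t := by
      rw [← sq]
      exact (hmn.pow 2 2).dvd_of_dvd_mul_right (Dvd.intro_left _ h)
    exact Nat.isUnit_iff.1 (ht m h1)
  obtain ⟨g, m', n', hg, hcop, rfl, rfl⟩ := Nat.exists_coprime' (Nat.gcd_pos_of_pos_left n hm)
  have h' : s * m' ^ 2 = t * n' ^ 2 := by
    refine Nat.eq_of_mul_eq_mul_right (show 0 < g ^ 2 by positivity) ?_
    linarith [show s * (m' * g) ^ 2 = s * m' ^ 2 * g ^ 2 by ring,
      show t * (n' * g) ^ 2 = t * n' ^ 2 * g ^ 2 by ring]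
  have hm1 := key ht hcop h'
  have hn1 := key hs hcop.symm h'.symm
  subst hm1 hn1
  exact ⟨by simpa using h', rfl⟩

/-- For `A > 0` the quartic `3x⁴ + 6Ax² + 12Bx - A²` is convex and negative at zero, so it has a
single positive root. -/
lemma root_unique {A B r r' : ℤ} (hA : 0 < A) (hr : 0 < r) (hr' : 0 < r')
    (h : 3 * r ^ 4 + 6 * A * r ^ 2 + 12 * B * r = A ^ 2)
    (h' : 3 * r' ^ 4 + 6 * A * r' ^ 2 + 12 * B * r' = A ^ 2) : r = r' := by
  have hpos : 0 < A ^ 2 + 3 * r * r' * (r ^ 2 + r * r' + r' ^ 2) + 6 * A * r * r' := by positivity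
  have hmul : (r - r') * (A ^ 2 + 3 * r * r' * (r ^ 2 + r * r' + r' ^ 2) + 6 * A * r * r') = 0 := by
    linear_combination r' * h - r * h'
  rcases mul_eq_zero.1 hmul with h0 | h0
  · linarith
  · exact absurd h0 hpos.ne'

/-- The pair of coefficients with root `4 s m²` and `A = 12 s m n`. -/
def pairOfTriple (q : Σ _ : ℕ, ℕ × ℕ) : ℤ × ℤ :=
  (12 * q.2.1 * q.1 * q.2.2,
    q.2.1 * (3 * q.2.2 ^ 2 - 24 * q.2.1 * q.1 ^ 3 * q.2.2 - 16 * q.2.1 ^ 2 * q.1 ^ 6))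

/-- Triples `⟨m, s, n⟩` with `s` squarefree, `s m² ≤ N` and `n ≤ N m`. -/
def triples (N : ℕ) : Finset (Σ _ : ℕ, ℕ × ℕ) :=
  (Finset.Ioc 0 N.sqrt).sigma fun m =>
    ((Finset.Ioc 0 (N / m ^ 2)).filter Squarefree) ×ˢ Finset.Ioc 0 (N * m)

lemma mem_triples {N m s n : ℕ} : ⟨m, s, n⟩ ∈ triples N ↔
    (0 < m ∧ m ≤ N.sqrt) ∧ ((0 < s ∧ s ≤ N / m ^ 2) ∧ Squarefree s) ∧ 0 < n ∧ n ≤ N * m := by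
  simp [triples]

/-- The number `4 s m²` is a root of the division polynomial of `pairOfTriple ⟨m, s, n⟩`. -/
lemma root_pairOfTriple (s m n : ℤ) :
    3 * (4 * s * m ^ 2) ^ 4 + 6 * (12 * s * m * n) * (4 * s * m ^ 2) ^ 2 +
      12 * (s * (3 * n ^ 2 - 24 * s * m ^ 3 * n - 16 * s ^ 2 * m ^ 6)) * (4 * s * m ^ 2) =
    (12 * s * m * n) ^ 2 := by
  ring

lemma injOn_pairOfTriple (N : ℕ) : Set.InjOn pairOfTriple (triples N) := by
  rintro ⟨m, s, n⟩ h ⟨m', s', n'⟩ h' heq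
  rw [Finset.mem_coe, mem_triples] at h h'
  obtain ⟨⟨hm, -⟩, ⟨⟨hs, -⟩, hsq⟩, hn, -⟩ := h
  obtain ⟨⟨hm', -⟩, ⟨⟨hs', -⟩, hsq'⟩, hn', -⟩ := h'
  obtain ⟨h1, h2⟩ := Prod.ext_iff.1 heq
  simp only [pairOfTriple] at h1 h2
  have e := root_pairOfTriple s' m' n'
  rw [← h1, ← h2] at e
  have hr := root_unique (by positivity) (by positivity) (by positivity)
    (root_pairOfTriple s m n) e
  have hr' : s * m ^ 2 = s' * m' ^ 2 := by
    have : (s * m ^ 2 : ℤ) = s' * m' ^ 2 := by linarith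
    exact_mod_cast this
  obtain ⟨rfl, rfl⟩ := eq_of_squarefree_mul_sq hsq hsq' hm hr'
  have hn : n = n' := by
    have h3 : 12 * s * m * n = 12 * s * m * n' := by exact_mod_cast h1
    exact Nat.eq_of_mul_eq_mul_left (by positivity) h3
  rw [hn]

lemma pairOfTriple_mem {N : ℕ} {Y : ℝ} (hN : 0 < N) (hNY : (N : ℝ) ≤ Y / 4)
    {q : Σ _ : ℕ, ℕ × ℕ} (hq : q ∈ triples N) : pairOfTriple q ∈ isogenyPairs Y := by
  obtain ⟨m, s, n⟩ := q
  rw [mem_triples] at hq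
  obtain ⟨⟨hm, -⟩, ⟨⟨hs, hsN⟩, -⟩, hn, hnN⟩ := hq
  have hA : (0 : ℤ) < 12 * s * m * n := by positivity
  rw [Nat.le_div_iff_mul_le (by positivity)] at hsN
  have hm0 : (0 : ℝ) < m := by positivity
  have hY : 0 < Y := by
    have : (0 : ℝ) < N := by positivity
    linarith
  -- In terms of `a = s m²` and `b = n / m` the coefficients are homogeneous of degrees two
  -- and three.
  obtain ⟨a, ha⟩ : ∃ a : ℝ, a = s * m ^ 2 := ⟨_, rfl⟩
  obtain ⟨b, hb⟩ : ∃ b : ℝ, b = n / m := ⟨_, rfl⟩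
  have hb' : (n : ℝ) = b * m := by rw [hb]; field_simp
  have ha0 : 0 < a := by rw [ha]; positivity
  have hb0 : 0 < b := by rw [hb]; positivity
  have haY : a ≤ Y / 4 := by
    have : (s * m ^ 2 : ℝ) ≤ N := by exact_mod_cast hsN
    linarith
  have hbY : b ≤ Y / 4 := by
    have : (n : ℝ) ≤ N * m := by exact_mod_cast hnN
    rw [hb, div_le_iff₀ hm0]
    nlinarith
  refine ⟨hA.ne', ?_, ?_, ?_, 4 * s * m ^ 2, root_pairOfTriple s m n⟩
  · have : (0 : ℤ) < (12 * s * m * n) ^ 3 := by positivity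
    simp only [pairOfTriple]
    nlinarith [sq_nonneg ((s : ℤ) * (3 * n ^ 2 - 24 * s * m ^ 3 * n - 16 * s ^ 2 * m ^ 6))]
  · have e : (((pairOfTriple ⟨m, s, n⟩).1 : ℤ) : ℝ) = 12 * (a * b) := by
      simp only [pairOfTriple]
      push_cast
      rw [hb', ha]
      ring
    rw [e, abs_of_pos (by positivity)]
    have : a * b ≤ Y / 4 * (Y / 4) := by gcongr
    nlinarith
  · have e : (((pairOfTriple ⟨m, s, n⟩).2 : ℤ) : ℝ) =
        3 * (a * b * b) - 24 * (a * a * b) - 16 * (a * a * a) := by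
      simp only [pairOfTriple]
      push_cast
      rw [hb', ha]
      ring
    have h1 : a * b * b ≤ Y / 4 * (Y / 4) * (Y / 4) := by gcongr
    have h2 : a * a * b ≤ Y / 4 * (Y / 4) * (Y / 4) := by gcongr
    have h3 : a * a * a ≤ Y / 4 * (Y / 4) * (Y / 4) := by gcongr
    have h4 : 0 < a * b * b := by positivity
    have h5 : 0 < a * a * b := by positivity
    have h6 : 0 < a * a * a := by positivity
    have h7 : 0 < Y ^ 3 := by positivity
    rw [e, abs_lt]
    constructor <;> nlinarith

/-- For each `m ≤ √N` there are at least of order `N / m²` choices of `s` and `N m` choices of `n`,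
and `∑ N² / m` over these `m` is at least of order `N² log N`. -/
lemma le_card_triples {N : ℕ} (hN : 0 < N) :
    (N : ℝ) ^ 2 / 16 * Real.log N ≤ (triples N).card := by
  have hterm (m : ℕ) (hm : m ∈ Finset.Ioc 0 N.sqrt) : (N : ℝ) ^ 2 / 8 * (m : ℝ)⁻¹ ≤
      ((((Finset.Ioc 0 (N / m ^ 2)).filter Squarefree) ×ˢ Finset.Ioc 0 (N * m)).card : ℕ) := by
    rw [Finset.mem_Ioc] at hm
    have hm0 : (0 : ℝ) < m := by exact_mod_cast hm.1
    have hm2 : m ^ 2 ≤ N := Nat.le_sqrt'.1 hm.2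
    have h1 := le_four_mul_card_squarefree (N / m ^ 2)
    have h2 : N ≤ 2 * m ^ 2 * (N / m ^ 2) := by
      have h3 := Nat.lt_mul_div_succ N (show 0 < m ^ 2 by have := hm.1; positivity)
      have h4 : 1 ≤ N / m ^ 2 := (Nat.one_le_div_iff (by have := hm.1; positivity)).2 hm2
      nlinarith
    have h5 : N ≤ 8 * m ^ 2 * ((Finset.Ioc 0 (N / m ^ 2)).filter Squarefree).card := by
      nlinarith
    have h6 : (N : ℝ) ≤ 8 * m ^ 2 * ((Finset.Ioc 0 (N / m ^ 2)).filter Squarefree).card := by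
      exact_mod_cast h5
    rw [Finset.card_product, Nat.card_Ioc, Nat.sub_zero]
    push_cast
    rw [← div_eq_mul_inv, div_le_iff₀ hm0]
    nlinarith [mul_le_mul_of_nonneg_left h6 (Nat.cast_nonneg (α := ℝ) N)]
  have hlog : Real.log N / 2 ≤ ∑ m ∈ Finset.Ioc 0 N.sqrt, (m : ℝ)⁻¹ := by
    have h1 := log_add_one_le_harmonic N.sqrt
    rw [harmonic_eq_sum_Icc, show Finset.Icc 1 N.sqrt = Finset.Ioc 0 N.sqrt from rfl] at h1
    push_cast at h1
    have h2 : (N : ℝ) ≤ ((N.sqrt : ℝ) + 1) ^ 2 := by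
      exact_mod_cast (Nat.lt_succ_sqrt' N).le
    have h3 := Real.log_le_log (by positivity) h2
    rw [Real.log_pow] at h3
    push_cast at h3
    linarith
  rw [triples, Finset.card_sigma]
  push_cast
  calc (N : ℝ) ^ 2 / 16 * Real.log N = (N : ℝ) ^ 2 / 8 * (Real.log N / 2) := by ring
    _ ≤ (N : ℝ) ^ 2 / 8 * ∑ m ∈ Finset.Ioc 0 N.sqrt, (m : ℝ)⁻¹ := by gcongr
    _ = ∑ m ∈ Finset.Ioc 0 N.sqrt, (N : ℝ) ^ 2 / 8 * (m : ℝ)⁻¹ := by rw [Finset.mul_sum]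
    _ ≤ _ := Finset.sum_le_sum hterm

lemma le_ncard_isogenyPairs {Y : ℝ} (hY : 64 ≤ Y) :
    Y ^ 2 * Real.log Y / 2048 ≤ (isogenyPairs Y).ncard := by
  have hY0 : 0 < Y := by linarith
  have h1 : (⌊Y / 4⌋₊ : ℝ) ≤ Y / 4 := Nat.floor_le (by linarith)
  have h2 : Y / 8 ≤ (⌊Y / 4⌋₊ : ℝ) := by linarith [Nat.sub_one_lt_floor (Y / 4)]
  have hN : 0 < ⌊Y / 4⌋₊ := by
    have : (0 : ℝ) < ⌊Y / 4⌋₊ := by linarith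
    exact_mod_cast this
  have h3 : (triples ⌊Y / 4⌋₊).card ≤ (isogenyPairs Y).ncard := by
    rw [← Set.ncard_coe_finset]
    exact Set.ncard_le_ncard_of_injOn _ (fun q hq => pairOfTriple_mem hN h1 hq)
      (injOn_pairOfTriple _) (finite_isogenyPairs hY0)
  have h4 : Real.log Y / 2 ≤ Real.log (⌊Y / 4⌋₊ : ℝ) := by
    have h5 : Real.log Y ≤ Real.log ((⌊Y / 4⌋₊ : ℝ) ^ 2) := by
      refine Real.log_le_log hY0 ?_
      have : (Y / 8) ^ 2 ≤ (⌊Y / 4⌋₊ : ℝ) ^ 2 := by gcongr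
      nlinarith
    rw [Real.log_pow] at h5
    push_cast at h5
    linarith
  have hlog : 0 ≤ Real.log Y := Real.log_nonneg (by linarith)
  calc Y ^ 2 * Real.log Y / 2048 = (Y / 8) ^ 2 / 16 * (Real.log Y / 2) := by ring
    _ ≤ (⌊Y / 4⌋₊ : ℝ) ^ 2 / 16 * Real.log (⌊Y / 4⌋₊ : ℝ) := by gcongr
    _ ≤ (triples ⌊Y / 4⌋₊).card := le_card_triples hN
    _ ≤ (isogenyPairs Y).ncard := by exact_mod_cast h3

/-! ### Passing to reduced pairs -/

/-- Every pair is `(k⁴ a, k⁶ b)` for a reduced pair `(a, b)`, where `k` is as large as possible. -/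
lemma isogenyPairs_subset_biUnion {Y : ℝ} (hY : 0 < Y) :
    isogenyPairs Y ⊆ ⋃ k ∈ Finset.Ioc 0 ⌊Y⌋₊,
      (fun p : ℤ × ℤ => ((k : ℤ) ^ 4 * p.1, (k : ℤ) ^ 6 * p.2)) ''
        reducedIsogenyPairs (Y / (k : ℝ) ^ 2) := by
  rintro ⟨A, B⟩ ⟨hA0, hΔ, hA, hB, hr⟩
  dsimp only at hA0 hΔ hA hB hr
  have hbound (k : ℕ) (hk : (k : ℤ) ^ 4 ∣ A) : k ≤ ⌊Y⌋₊ := by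
    have h1 : (k : ℝ) ^ 4 ≤ |(A : ℝ)| := by
      have := Int.le_of_dvd (abs_pos.2 hA0) ((dvd_abs _ _).2 hk)
      exact_mod_cast this
    have h2 : (k : ℝ) ^ 2 < Y := by
      refine lt_of_pow_lt_pow_left₀ 2 hY.le ?_
      linarith [show ((k : ℝ) ^ 2) ^ 2 = (k : ℝ) ^ 4 by ring]
    refine Nat.le_floor (le_trans ?_ h2.le)
    exact_mod_cast Nat.le_self_pow two_ne_zero k
  let P : ℕ → Prop := fun k => (k : ℤ) ^ 4 ∣ A ∧ (k : ℤ) ^ 6 ∣ B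
  classical
  have hP1 : P 1 := by simp [P]
  obtain ⟨k, hk⟩ : ∃ k, k = Nat.findGreatest P ⌊Y⌋₊ := ⟨_, rfl⟩
  have hPk : P k := hk ▸ Nat.findGreatest_spec (hbound 1 hP1.1) hP1
  have hk1 : 1 ≤ k := hk ▸ Nat.le_findGreatest (hbound 1 hP1.1) hP1
  obtain ⟨⟨a, ha⟩, ⟨b, hb⟩⟩ := hPk
  have hkR : (0 : ℝ) < k := by exact_mod_cast hk1
  have hkZ : (0 : ℤ) < k := by exact_mod_cast hk1
  simp only [Set.mem_iUnion, Finset.mem_Ioc]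
  refine ⟨k, ⟨hk1, hk ▸ Nat.findGreatest_le _⟩, (a, b), ⟨⟨?_, ?_, ?_, ?_, ?_⟩, ?_⟩, ?_⟩
  · rintro rfl
    simp at ha
    exact hA0 ha
  · intro h0
    apply hΔ
    dsimp only at h0
    rw [ha, hb]
    linear_combination (k : ℤ) ^ 12 * h0
  · rw [div_pow, lt_div_iff₀ (by positivity)]
    rw [ha] at hA
    push_cast at hA
    rw [abs_mul, abs_of_pos (a := (k : ℝ) ^ 4) (by positivity)] at hA
    linarith [show |(a : ℝ)| * ((k : ℝ) ^ 2) ^ 2 = (k : ℝ) ^ 4 * |(a : ℝ)| by ring]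
  · rw [div_pow, lt_div_iff₀ (by positivity)]
    rw [hb] at hB
    push_cast at hB
    rw [abs_mul, abs_of_pos (a := (k : ℝ) ^ 6) (by positivity)] at hB
    linarith [show |(b : ℝ)| * ((k : ℝ) ^ 2) ^ 3 = (k : ℝ) ^ 6 * |(b : ℝ)| by ring]
  · obtain ⟨r, hr⟩ := hr
    refine exists_int_root ⟨r / (k : ℚ) ^ 2, ?_⟩
    have hrQ : 3 * (r : ℚ) ^ 4 + 6 * A * (r : ℚ) ^ 2 + 12 * B * r = (A : ℚ) ^ 2 := by
      exact_mod_cast hr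
    rw [ha, hb] at hrQ
    push_cast at hrQ
    have hkQ : (k : ℚ) ≠ 0 := by exact_mod_cast hkZ.ne'
    field_simp
    linear_combination hrQ
  · rw [isReducedPair_iff]
    rintro l hl ⟨⟨a', ha'⟩, ⟨b', hb'⟩⟩
    dsimp only at ha' hb'
    have hPkl : P (k * l) := by
      refine ⟨⟨a', ?_⟩, ⟨b', ?_⟩⟩
      · rw [ha, ha']; push_cast; ring
      · rw [hb, hb']; push_cast; ring
    have h1 : k * l ≤ Nat.findGreatest P ⌊Y⌋₊ := Nat.le_findGreatest (hbound _ hPkl.1) hPkl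
    rw [← hk] at h1
    nlinarith
  · rw [ha, hb]

lemma isogenyPairs_eq_empty {Y : ℝ} (hY : 0 ≤ Y) (hY1 : Y < 1) : isogenyPairs Y = ∅ := by
  refine Set.eq_empty_of_forall_notMem ?_
  rintro ⟨A, B⟩ ⟨hA0, -, hA, -⟩
  have h1 : (1 : ℝ) ≤ |(A : ℝ)| := by exact_mod_cast Int.one_le_abs hA0
  dsimp only at hA
  nlinarith

lemma isogenyPairs_mono {Y Z : ℝ} (hY : 0 ≤ Y) (h : Y ≤ Z) : isogenyPairs Y ⊆ isogenyPairs Z := by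
  rintro p ⟨h1, h2, h3, h4, h5⟩
  exact ⟨h1, h2, h3.trans_le (by gcongr), h4.trans_le (by gcongr), h5⟩

lemma ncard_isogenyPairs_div_le {Y : ℝ} (hY : 1 ≤ Y) {k : ℕ} (hk : 0 < k) :
    ((isogenyPairs (Y / (k : ℝ) ^ 2)).ncard : ℝ) ≤
      720 * (Y ^ 2 * (1 + Real.log Y)) * ((k : ℝ) ^ 2)⁻¹ := by
  have hk1 : (1 : ℝ) ≤ k := by exact_mod_cast hk
  have hk2 : (1 : ℝ) ≤ (k : ℝ) ^ 2 := one_le_pow₀ hk1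
  have hlog := Real.log_nonneg hY
  rcases lt_or_ge (Y / (k : ℝ) ^ 2) 1 with h | h
  · rw [isogenyPairs_eq_empty (by positivity) h, Set.ncard_empty, Nat.cast_zero]
    positivity
  · refine (ncard_isogenyPairs_le h).trans ?_
    have h1 : Y / (k : ℝ) ^ 2 ≤ Y := div_le_self (by linarith) hk2
    have h2 : (Y / (k : ℝ) ^ 2) ^ 2 ≤ Y ^ 2 * ((k : ℝ) ^ 2)⁻¹ := by
      rw [div_pow, div_eq_mul_inv]
      gcongr
      nlinarith
    calc 720 * ((Y / (k : ℝ) ^ 2) ^ 2 * (1 + Real.log (Y / (k : ℝ) ^ 2)))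
        ≤ 720 * (Y ^ 2 * ((k : ℝ) ^ 2)⁻¹ * (1 + Real.log Y)) := by
          gcongr
          linarith [Real.log_nonneg h]
      _ = 720 * (Y ^ 2 * (1 + Real.log Y)) * ((k : ℝ) ^ 2)⁻¹ := by ring

lemma ncard_isogenyPairs_le_sum {Y : ℝ} (hY : 0 < Y) :
    (isogenyPairs Y).ncard ≤
      ∑ k ∈ Finset.Ioc 0 ⌊Y⌋₊, (reducedIsogenyPairs (Y / (k : ℝ) ^ 2)).ncard := by
  have hfin (k : ℕ) (hk : k ∈ Finset.Ioc 0 ⌊Y⌋₊) :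
      (reducedIsogenyPairs (Y / (k : ℝ) ^ 2)).Finite := by
    have hk0 : (0 : ℝ) < k := by exact_mod_cast (Finset.mem_Ioc.1 hk).1
    exact (finite_isogenyPairs (by positivity)).subset fun p hp => hp.1
  refine (Set.ncard_le_ncard (isogenyPairs_subset_biUnion hY)
    (Set.Finite.biUnion (Finset.finite_toSet _) fun k hk => (hfin k hk).image _)).trans ?_
  refine (Finset.set_ncard_biUnion_le _ _).trans (Finset.sum_le_sum fun k hk => ?_)
  exact Set.ncard_image_le (hfin k hk)

/-- The curves whose equation can be reduced by a factor `k > K` are few by the upper bound, and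
each other curve is one of at most `K` scalings of a reduced one. -/
lemma le_ncard_reducedIsogenyPairs {Y : ℝ} (hY : 64 ≤ Y) :
    Y ^ 2 * Real.log Y / (4096 * 10 ^ 7) ≤ (reducedIsogenyPairs Y).ncard := by
  obtain ⟨K, hK⟩ : ∃ K : ℕ, K = 10 ^ 7 := ⟨_, rfl⟩
  have hKR : (K : ℝ) = 10 ^ 7 := by rw [hK]; norm_num
  have hY0 : 0 < Y := by linarith
  have hlog : 1 ≤ Real.log Y := by
    rw [Real.le_log_iff_exp_le hY0]
    linarith [Real.exp_one_lt_d9]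
  obtain ⟨R, hR⟩ : ∃ R : ℝ, R = (reducedIsogenyPairs Y).ncard := ⟨_, rfl⟩
  obtain ⟨U, hU⟩ : ∃ U : ℝ, U = 720 * (Y ^ 2 * (1 + Real.log Y)) := ⟨_, rfl⟩
  have hR0 : 0 ≤ R := by rw [hR]; positivity
  have hU0 : 0 ≤ U := by rw [hU]; positivity
  have hterm (k : ℕ) (hk : k ∈ Finset.Ioc 0 ⌊Y⌋₊) :
      ((reducedIsogenyPairs (Y / (k : ℝ) ^ 2)).ncard : ℝ) ≤
        (if k ≤ K then R else 0) + (if K < k then U * ((k : ℝ) ^ 2)⁻¹ else 0) := by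
    rw [Finset.mem_Ioc] at hk
    have hk1 : (1 : ℝ) ≤ k := by exact_mod_cast hk.1
    rcases le_or_gt k K with h | h
    · rw [if_pos h, if_neg (by omega), add_zero, hR]
      have h1 : reducedIsogenyPairs (Y / (k : ℝ) ^ 2) ⊆ reducedIsogenyPairs Y := fun p hp =>
        ⟨isogenyPairs_mono (by positivity) (div_le_self hY0.le (one_le_pow₀ hk1)) hp.1, hp.2⟩
      exact_mod_cast Set.ncard_le_ncard h1 ((finite_isogenyPairs hY0).subset fun p hp => hp.1)
    · rw [if_neg (by omega), if_pos h, zero_add, hU]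
      refine le_trans ?_ (ncard_isogenyPairs_div_le (by linarith) hk.1)
      have h1 : reducedIsogenyPairs (Y / (k : ℝ) ^ 2) ⊆ isogenyPairs (Y / (k : ℝ) ^ 2) :=
        fun p hp => hp.1
      exact_mod_cast Set.ncard_le_ncard h1 (finite_isogenyPairs (by positivity))
  have hsum : ((isogenyPairs Y).ncard : ℝ) ≤ K * R + U * (K : ℝ)⁻¹ := by
    have h1 : ((isogenyPairs Y).ncard : ℝ) ≤ ∑ k ∈ Finset.Ioc 0 ⌊Y⌋₊,
        ((reducedIsogenyPairs (Y / (k : ℝ) ^ 2)).ncard : ℝ) := by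
      exact_mod_cast ncard_isogenyPairs_le_sum hY0
    refine h1.trans ((Finset.sum_le_sum hterm).trans ?_)
    rw [Finset.sum_add_distrib, ← Finset.sum_filter, ← Finset.sum_filter]
    refine add_le_add ?_ ?_
    · rw [Finset.sum_const, nsmul_eq_mul]
      refine mul_le_mul_of_nonneg_right ?_ hR0
      have h2 : (Finset.Ioc 0 ⌊Y⌋₊).filter (· ≤ K) ⊆ Finset.Ioc 0 K := by
        intro k hk
        simp only [Finset.mem_filter, Finset.mem_Ioc] at hk ⊢
        exact ⟨hk.1.1, hk.2⟩
      have h3 := Finset.card_le_card h2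
      rw [Nat.card_Ioc, Nat.sub_zero] at h3
      exact_mod_cast h3
    · rw [← Finset.mul_sum]
      refine mul_le_mul_of_nonneg_left ?_ hU0
      have h2 : (Finset.Ioc 0 ⌊Y⌋₊).filter (K < ·) ⊆ Finset.Ioc K (max K ⌊Y⌋₊) := by
        intro k hk
        simp only [Finset.mem_filter, Finset.mem_Ioc] at hk ⊢
        exact ⟨hk.2, hk.1.2.trans (le_max_right _ _)⟩
      refine (Finset.sum_le_sum_of_subset_of_nonneg h2 fun _ _ _ => by positivity).trans ?_
      refine (sum_Ioc_inv_sq_le_sub (by omega) (le_max_left _ _)).trans ?_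
      exact sub_le_self _ (by positivity)
  have hlow := le_ncard_isogenyPairs hY
  rw [hKR] at hsum
  -- With `K = 10⁷` the tail `U / K` is at most half of the lower bound `Y² log Y / 2048`.
  have htail : U * (10 ^ 7 : ℝ)⁻¹ ≤ Y ^ 2 * Real.log Y / 4096 := by
    have h1 : Y ^ 2 * (1 + Real.log Y) ≤ Y ^ 2 * (2 * Real.log Y) := by
      gcongr
      linarith
    have h2 : 0 ≤ Y ^ 2 * Real.log Y := by positivity
    rw [hU]
    linarith
  rw [← hR]
  linarith

theorem countJNeZero_three_isTheta :
    (fun X : ℝ => (countJNeZero 3 X : ℝ)) =Θ[Filter.atTop]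
      (fun X : ℝ => X ^ (1 / 3 : ℝ) * Real.log X) := by
  refine isTheta_of_bounds (c₁ := 1 / (6 * (4096 * 10 ^ 7))) (c₂ := 240) (Y₀ := 64) (by norm_num)
    fun Y hY => ?_
  have hY0 : 0 ≤ Y := by linarith
  have hg : (Y ^ 6) ^ (1 / 3 : ℝ) * Real.log (Y ^ 6) = 6 * (Y ^ 2 * Real.log Y) := by
    have h1 : (Y ^ 6) ^ (1 / 3 : ℝ) = Y ^ 2 := by
      rw [← Real.rpow_natCast, ← Real.rpow_natCast, ← Real.rpow_mul hY0]
      norm_num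
    rw [h1, Real.log_pow]
    push_cast
    ring
  have hlog : 1 ≤ Real.log Y := by
    rw [Real.le_log_iff_exp_le (by linarith)]
    linarith [Real.exp_one_lt_d9]
  have hlow := le_ncard_reducedIsogenyPairs hY
  have hup : ((reducedIsogenyPairs Y).ncard : ℝ) ≤ 720 * (Y ^ 2 * (1 + Real.log Y)) := by
    refine le_trans ?_ (ncard_isogenyPairs_le (by linarith))
    have h1 : reducedIsogenyPairs Y ⊆ isogenyPairs Y := fun p hp => hp.1
    exact_mod_cast Set.ncard_le_ncard h1 (finite_isogenyPairs (by linarith))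
  have h2 : Y ^ 2 * (1 + Real.log Y) ≤ Y ^ 2 * (2 * Real.log Y) := by
    gcongr
    linarith
  have h3 : 0 ≤ Y ^ 2 * Real.log Y := by positivity
  rw [hg, countJNeZero_three hY0]
  exact ⟨by linarith, by linarith, by linarith⟩

end EllipticCount

theorem mainTheorem3 :
    ((fun X : ℝ => (EllipticCount.countJNeZero 3 X : ℝ))
      =Θ[Filter.atTop] (fun X : ℝ => X ^ (1 / 3 : ℝ) * Real.log X)) ∧
    (∀ E : EllipticCount.EllipticCurveQ, E.1.j ≠ 0 →
      (EllipticCount.HasRationalIsogeny 3 E ↔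
        ∃ d t : ℚ, d ≠ 0 ∧ EllipticCount.IsIsomorphic E.1 (EllipticCount.familyTwist d t))) ∧
    ((fun X : ℝ => (EllipticCount.countJEqZero 3 X : ℝ))
      =Θ[Filter.atTop] (fun X : ℝ => X ^ (1 / 2 : ℝ))) :=
  ⟨EllipticCount.countJNeZero_three_isTheta,
    EllipticCount.hasRationalIsogeny_three_iff_familyTwist,
    EllipticCount.countJEqZero_three_isTheta⟩
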